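/- Let $\beta\in(0,2]$ and let $W$ be a standard symmetric stable process of index $\beta$, i.e. a L\'evy process with $\mathbb{E}(e^{iuW_t})=e^{-t|u|^\beta/2}$ (a Wiener process if $\beta=2$). Let $h_\beta$ be the density of $W_1$; it is $C^\infty$ and positive. Put $$\mathcal I(\beta)=\int_{\mathbb R}\frac{(h_\beta(w)+w\,h_\beta'(w))^2}{h_\beta(w)}\,dw,\qquad \mathcal J(\beta)=\int_{\mathbb R}\frac{h_\beta'(w)^2}{h_\beta(w)}\,dw ;$$ both are finite. Let $Y$ be a standard Poisson process (jumps of size $1$, intensity $1$) independent of $W$, and let $X_t=\sigma W_t+\theta Y_t$ with $\sigma>0$ and $\theta\in\mathbb R$. For $\Delta>0$ the variable $X_\Delta$ has a continuous positive density $p_\Delta(x\,|\,\sigma,\theta)$, differentiable in $\sigma$ and in $\theta$, and the entries of the Fisher information matrix for $(\sigma,\theta)$ of a single observation of $X_\Delta$, $$I^{\sigma\sigma}_\Delta=\int\frac{(\partial_\sigma p_\Delta)^2}{p_\Delta}\,dx,\qquad I^{\sigma\theta}_\Delta=\int\frac{\partial_\sigma p_\Delta\,\partial_\theta p_\Delta}{p_\Delta}\,dx,\qquad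 I^{\theta\theta}_\Delta=\int\frac{(\partial_\theta p_\Delta)^2}{p_\Delta}\,dx ,$$ exist (the integrals converge absolutely). Then, for fixed $\beta,\sigma,\theta$, as $\Delta\downarrow0$, $$I^{\sigma\sigma}_\Delta\to\frac{\mathcal I(\beta)}{\sigma^2},\qquad \Delta^{1/\beta-1/2}\,I^{\sigma\theta}_\Delta\to0,$$ and, if $\theta\neq0$, $$\Delta^{2/\beta-1}\,I^{\theta\theta}_\Delta\to\frac{\mathcal J(\beta)}{\sigma^2}.$$ -/

import Mathlib

open MeasureTheory ProbabilityTheory Filter Topology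
open scoped NNReal

noncomputable section

/-! ### The processes -/

/-- A real-valued Lévy process: it starts at `0`, has independent and stationary increments, and
is continuous in probability. (Regularity of the paths plays no role here and is not required.) -/
structure IsLevyProcess {Ω : Type*} [MeasurableSpace Ω] (X : ℝ≥0 → Ω → ℝ) (P : Measure Ω) :
    Prop where
  aemeasurable : ∀ t, AEMeasurable (X t) P
  zero : ∀ᵐ ω ∂P, X 0 ω = 0
  indepIncrements : HasIndepIncrements X P
  stationary : ∀ s t, IdentDistrib (fun ω => X (s + t) ω - X s ω) (X t) P P
  tendstoInMeasure : ∀ t, TendstoInMeasure P X (𝓝 t) (X t)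

/-- `W` is a standard symmetric stable process of index `β`: a Lévy process with
`E (exp (i u W_t)) = exp (- t |u| ^ β / 2)`. For `β = 2` it is a Wiener process. -/
structure IsStandardSymmetricStable {Ω : Type*} [MeasurableSpace Ω] (β : ℝ) (W : ℝ≥0 → Ω → ℝ)
    (P : Measure Ω) : Prop where
  levy : IsLevyProcess W P
  charFun_eq : ∀ (t : ℝ≥0) (u : ℝ),
    charFun (P.map (W t)) u = Complex.exp ((-((t : ℝ) * |u| ^ β / 2) : ℝ) : ℂ)

/-- `Y` is a standard Poisson process (jumps of size `1`, intensity `1`): a Lévy process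
such that `Y_t` has the Poisson law of parameter `t`. -/
structure IsStandardPoisson {Ω : Type*} [MeasurableSpace Ω] (Y : ℝ≥0 → Ω → ℝ)
    (P : Measure Ω) : Prop where
  levy : IsLevyProcess Y P
  law_eq : ∀ t : ℝ≥0, P.map (Y t) = (poissonMeasure t).map (fun n : ℕ => (n : ℝ))

/-! ### Continuous densities -/

/-- `f` is a (nonnegative) continuous density of `μ` with respect to Lebesgue measure. -/
structure IsContinuousDensity (μ : Measure ℝ) (f : ℝ → ℝ) : Prop where
  continuous : Continuous f
  nonneg : ∀ x, 0 ≤ f x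
  eq_withDensity : μ = volume.withDensity (fun x => ENNReal.ofReal (f x))

/-- A finite measure has at most one continuous density. -/
theorem IsContinuousDensity.unique {μ : Measure ℝ} [IsFiniteMeasure μ] {f g : ℝ → ℝ}
    (hf : IsContinuousDensity μ f) (hg : IsContinuousDensity μ g) : f = g := by
  have hfm : Measurable (fun x => ENNReal.ofReal (f x)) := hf.continuous.measurable.ennreal_ofReal
  have hgm : Measurable (fun x => ENNReal.ofReal (g x)) := hg.continuous.measurable.ennreal_ofReal
  have h : (fun x => ENNReal.ofReal (f x)) =ᵐ[volume] fun x => ENNReal.ofReal (g x) :=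
    (withDensity_eq_iff_of_sigmaFinite hfm.aemeasurable hgm.aemeasurable).1
      (hf.eq_withDensity.symm.trans hg.eq_withDensity)
  have h' : f =ᵐ[volume] g := by
    filter_upwards [h] with x hx
    exact (ENNReal.ofReal_eq_ofReal_iff (hf.nonneg x) (hg.nonneg x)).1 hx
  exact (hf.continuous.ae_eq_iff_eq volume hg.continuous).1 h'

open Classical in
/-- The continuous density of `μ` (and `0` if there is none). -/
def continuousDensity (μ : Measure ℝ) : ℝ → ℝ :=
  if h : ∃ f, IsContinuousDensity μ f then h.choose else 0

/-! ### Fisher information of a model with two real parameters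

`Q s t` is the law of the observation when the parameters are `(s, t)`. -/

/-- The density `p (x | s, t)` of the observation. -/
def modelDensity (Q : ℝ → ℝ → Measure ℝ) (s t x : ℝ) : ℝ := continuousDensity (Q s t) x

/-- The derivative of the density in the first parameter. -/
def modelDeriv₁ (Q : ℝ → ℝ → Measure ℝ) (s t x : ℝ) : ℝ :=
  deriv (fun s' => modelDensity Q s' t x) s

/-- The derivative of the density in the second parameter. -/
def modelDeriv₂ (Q : ℝ → ℝ → Measure ℝ) (s t x : ℝ) : ℝ :=
  deriv (fun t' => modelDensity Q s t' x) t

/-- The entry `(1, 1)` of the Fisher information matrix. -/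
def fisherInfo₁₁ (Q : ℝ → ℝ → Measure ℝ) (s t : ℝ) : ℝ :=
  ∫ x, modelDeriv₁ Q s t x ^ 2 / modelDensity Q s t x

/-- The entry `(1, 2)` of the Fisher information matrix. -/
def fisherInfo₁₂ (Q : ℝ → ℝ → Measure ℝ) (s t : ℝ) : ℝ :=
  ∫ x, modelDeriv₁ Q s t x * modelDeriv₂ Q s t x / modelDensity Q s t x

/-- The entry `(2, 2)` of the Fisher information matrix. -/
def fisherInfo₂₂ (Q : ℝ → ℝ → Measure ℝ) (s t : ℝ) : ℝ :=
  ∫ x, modelDeriv₂ Q s t x ^ 2 / modelDensity Q s t x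

/-- The Fisher information matrix at `(s, t)` exists: the laws have continuous densities around
`(s, t)`, which are positive and differentiable in the parameters at `(s, t)`, and the integrals
that define the entries converge. -/
structure HasFisherInfo (Q : ℝ → ℝ → Measure ℝ) (s t : ℝ) : Prop where
  density : ∀ᶠ q : ℝ × ℝ in 𝓝 (s, t), IsContinuousDensity (Q q.1 q.2) (modelDensity Q q.1 q.2)
  pos : ∀ x, 0 < modelDensity Q s t x
  differentiable₁ : ∀ x, DifferentiableAt ℝ (fun s' => modelDensity Q s' t x) s
  differentiable₂ : ∀ x, DifferentiableAt ℝ (fun t' => modelDensity Q s t' x) t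
  integrable₁₁ : Integrable fun x => modelDeriv₁ Q s t x ^ 2 / modelDensity Q s t x
  integrable₁₂ : Integrable fun x =>
    modelDeriv₁ Q s t x * modelDeriv₂ Q s t x / modelDensity Q s t x
  integrable₂₂ : Integrable fun x => modelDeriv₂ Q s t x ^ 2 / modelDensity Q s t x

/-- The law of `X_Δ = σ W_Δ + θ Y_Δ`, as a function of the parameters `(σ, θ)`. -/
def additiveModel {Ω : Type*} [MeasurableSpace Ω] (P : Measure Ω) (W Y : ℝ≥0 → Ω → ℝ) (Δ : ℝ≥0)
    (σ θ : ℝ) : Measure ℝ :=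
  P.map (fun ω => σ * W Δ ω + θ * Y Δ ω)

/-! ### The stable density and its informations -/

/-- The density `h_β` of the symmetric stable law with characteristic function
`exp (- |u| ^ β / 2)`, by Fourier inversion (this characteristic function is even and real). -/
def stableDensity (β w : ℝ) : ℝ :=
  (2 * Real.pi)⁻¹ * ∫ u : ℝ, Real.cos (u * w) * Real.exp (-(|u| ^ β / 2))

/-- The integrand `(h_β + w h_β') ^ 2 / h_β` of the scale information. -/
def scaleIntegrand (β w : ℝ) : ℝ :=
  (stableDensity β w + w * deriv (stableDensity β) w) ^ 2 / stableDensity β w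

/-- The integrand `(h_β') ^ 2 / h_β` of the translation information. -/
def translationIntegrand (β w : ℝ) : ℝ :=
  deriv (stableDensity β) w ^ 2 / stableDensity β w

/-- `𝓘(β)`: the Fisher information at `σ = 1` in the model `σ W_1`. -/
def scaleInfo (β : ℝ) : ℝ := ∫ w, scaleIntegrand β w

/-- `𝓙(β)`: the Fisher information for `a` in the translation model `W_1 + a`. -/
def translationInfo (β : ℝ) : ℝ := ∫ w, translationIntegrand β w

end

/-!
# Fisher information of a stable process with superimposed Poisson jumps

Everything rests on the representation of the symmetric stable law as a mixture of centred Gaussian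
laws (`exists_isGaussianScaleMixture`). The mixing law is that of the square root of a positive
`β / 2`-stable variable, which is obtained as a weak limit of normalised sums of Pareto variables
(`exists_positiveStable`); the Laplace transform shows that its inverse is integrable. The
representation makes the stable density `h` positive and unimodal, bounds `h`, `h'` and `w h'`, and
makes both informations finite, because `(a, b) ↦ a ^ 2 / b` is convex and so the information
of a mixture is at most the mean of the informations of its components
(`lintegral_ofReal_sq_integral_div_le`). Unimodality and the behaviour of the characteristic
function at `0` give the tail bound `h (z) = O (|z| ^ (-1 - β))`.

The observation is `σ Δ ^ (1 / β)` times `W₁ + δ N`, where `N` is a Poisson variable of parameter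
`Δ` and `δ = θ / (σ Δ ^ (1 / β))`, and its density is a mixture over `N`.

* The same convexity bounds the information on `σ` by `𝓘(β) / σ ^ 2`, and the information on `θ` by
  `(Δ + Δ ^ 2) 𝓙(β) / (σ Δ ^ (1 / β)) ^ 2`.
* The matching lower bounds come from Fatou's lemma: around `0` the integrand for `σ` converges to
  that of `𝓘(β)` since `N = 0` with probability close to `1`. Around `δ`, after division by `Δ`, the
  integrand for `θ` converges to that of `𝓙(β)` by size biasing of the Poisson law; the tail bound
  makes the contribution of `N = 0` to the density negligible there. An upper bound of integrals by
  the integral of the pointwise limit is all that is needed for convergence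
  (`tendsto_integral_of_integral_le`).
* The mixed information is an inner product of two functions in `L²`, one of which converges
  strongly while the other, suitably normalised, is bounded and tends to `0` pointwise; hence it
  tends to `0` (`tendsto_integral_mixed`).
-/

/-! ### Convexity of the information and convergence of integrals -/

/-- Cauchy–Schwarz in the form in which it bounds the Fisher information of a mixture: the map
`(a, b) ↦ a ^ 2 / b` is convex on the half plane `b > 0`. -/
theorem ofReal_sq_integral_div_le {K : Type*} [MeasurableSpace K] {κ : Measure K} {f g : K → ℝ}
    (hf : Integrable f κ) (hg : Integrable g κ) (hpos : ∀ᵐ k ∂κ, 0 < g k) :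
    ENNReal.ofReal ((∫ k, f k ∂κ) ^ 2 / ∫ k, g k ∂κ) ≤
      ∫⁻ k, ENNReal.ofReal (f k ^ 2 / g k) ∂κ := by
  by_cases htop : ∫⁻ k, ENNReal.ofReal (f k ^ 2 / g k) ∂κ = ⊤
  · simp [htop]
  have hnn : 0 ≤ᵐ[κ] fun k => f k ^ 2 / g k := by
    filter_upwards [hpos] with k hk
    positivity
  have hm : AEStronglyMeasurable (fun k => f k ^ 2 / g k) κ :=
    ((hf.aemeasurable.pow_const 2).div hg.aemeasurable).aestronglyMeasurable
  have hi : Integrable (fun k => f k ^ 2 / g k) κ := by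
    refine ⟨hm, ?_⟩
    rw [hasFiniteIntegral_iff_ofReal hnn]
    exact lt_top_iff_ne_top.2 htop
  rw [← ofReal_integral_eq_lintegral_ofReal hi hnn]
  apply ENNReal.ofReal_le_ofReal
  set F := ∫ k, f k ∂κ with hF
  set G := ∫ k, g k ∂κ with hG
  rcases eq_or_ne G 0 with h0 | h0
  · rw [h0, div_zero]
    exact integral_nonneg_of_ae hnn
  -- integrate `f ^ 2 / g ≥ 2 c f - c ^ 2 g` at the optimal slope `c = F / G`
  have key : ∫ k, (2 * (F / G) * f k - (F / G) ^ 2 * g k) ∂κ ≤ ∫ k, f k ^ 2 / g k ∂κ := by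
    refine integral_mono_ae ((hf.const_mul _).sub (hg.const_mul _)) hi ?_
    filter_upwards [hpos] with k hk
    rw [le_div_iff₀ hk]
    nlinarith [sq_nonneg (f k - F / G * g k)]
  rw [integral_sub (hf.const_mul _) (hg.const_mul _), integral_const_mul, integral_const_mul,
    ← hF, ← hG] at key
  have : F ^ 2 / G = 2 * (F / G) * F - (F / G) ^ 2 * G := by field_simp; ring
  linarith

/-- The Fisher information of a mixture is at most the average of the informations of its
components. -/
theorem lintegral_ofReal_sq_integral_div_le {K : Type*} [MeasurableSpace K] {κ : Measure K}
    [SFinite κ] {f g : K → ℝ → ℝ} (hfm : Measurable (Function.uncurry f))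
    (hgm : Measurable (Function.uncurry g)) (hf : ∀ x, Integrable (fun k => f k x) κ)
    (hg : ∀ x, Integrable (fun k => g k x) κ) (hpos : ∀ᵐ k ∂κ, ∀ x, 0 < g k x) :
    ∫⁻ x, ENNReal.ofReal ((∫ k, f k x ∂κ) ^ 2 / ∫ k, g k x ∂κ) ≤
      ∫⁻ k, (∫⁻ x, ENNReal.ofReal (f k x ^ 2 / g k x)) ∂κ := by
  calc ∫⁻ x, ENNReal.ofReal ((∫ k, f k x ∂κ) ^ 2 / ∫ k, g k x ∂κ)
      ≤ ∫⁻ x, (∫⁻ k, ENNReal.ofReal (f k x ^ 2 / g k x) ∂κ) := by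
        refine lintegral_mono fun x => ofReal_sq_integral_div_le (hf x) (hg x) ?_
        filter_upwards [hpos] with k hk using hk x
    _ = ∫⁻ k, (∫⁻ x, ENNReal.ofReal (f k x ^ 2 / g k x)) ∂κ := by
        refine lintegral_lintegral_swap (f := fun x k => ENNReal.ofReal (f k x ^ 2 / g k x)) ?_
        have : Measurable fun p : K × ℝ => ENNReal.ofReal (f p.1 p.2 ^ 2 / g p.1 p.2) :=
          ((hfm.pow_const 2).div hgm).ennreal_ofReal
        exact (this.comp measurable_swap).aemeasurable

/-- A converse of Fatou's lemma: pointwise convergence of nonnegative functions, together with an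
upper bound of the integrals by something that tends to the integral of the limit, gives
convergence of the integrals. -/
theorem tendsto_integral_of_integral_le {α ι : Type*} [MeasurableSpace α] {μ : Measure α}
    {l : Filter ι} [l.IsCountablyGenerated] {f : ι → α → ℝ} {F : α → ℝ} {b : ι → ℝ}
    (hf : ∀ᶠ i in l, Integrable (f i) μ) (hnn : ∀ᶠ i in l, ∀ x, 0 ≤ f i x) (hF : Integrable F μ)
    (hlim : ∀ x, Tendsto (fun i => f i x) l (𝓝 (F x)))
    (hle : ∀ᶠ i in l, ∫ x, f i x ∂μ ≤ b i) (hb : Tendsto b l (𝓝 (∫ x, F x ∂μ))) :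
    Tendsto (fun i => ∫ x, f i x ∂μ) l (𝓝 (∫ x, F x ∂μ)) := by
  rw [tendsto_iff_seq_tendsto]
  intro s hs
  have hFnn : ∀ x, 0 ≤ F x := fun x =>
    ge_of_tendsto ((hlim x).comp hs) (by filter_upwards [hs.eventually hnn] with n hn using hn x)
  obtain ⟨N, hN⟩ := eventually_atTop.1 ((hs.eventually hf).and ((hs.eventually hnn).and
    (hs.eventually hle)))
  rw [← tendsto_add_atTop_iff_nat N]
  have hs' : Tendsto (fun n => s (n + N)) atTop l := hs.comp (tendsto_add_atTop_nat N)
  have hN' : ∀ n, Integrable (f (s (n + N))) μ ∧ (∀ x, 0 ≤ f (s (n + N)) x) ∧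
    ∫ x, f (s (n + N)) x ∂μ ≤ b (s (n + N)) := fun n => hN _ (by omega)
  have hint : ∀ n, ENNReal.ofReal (∫ x, f (s (n + N)) x ∂μ) =
      ∫⁻ x, ENNReal.ofReal (f (s (n + N)) x) ∂μ := fun n =>
    ofReal_integral_eq_lintegral_ofReal (hN' n).1 (ae_of_all _ (hN' n).2.1)
  have hconv : Tendsto (fun n => ENNReal.ofReal (∫ x, f (s (n + N)) x ∂μ)) atTop
      (𝓝 (ENNReal.ofReal (∫ x, F x ∂μ))) := by
    refine tendsto_of_le_liminf_of_limsup_le ?_ ?_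
    · rw [ofReal_integral_eq_lintegral_ofReal hF (ae_of_all _ hFnn)]
      simp_rw [hint]
      calc ∫⁻ x, ENNReal.ofReal (F x) ∂μ
          = ∫⁻ x, liminf (fun n => ENNReal.ofReal (f (s (n + N)) x)) atTop ∂μ := by
            refine lintegral_congr fun x => ?_
            exact (Tendsto.liminf_eq ((ENNReal.continuous_ofReal.tendsto _).comp
              ((hlim x).comp hs'))).symm
        _ ≤ _ := lintegral_liminf_le' fun n => (hN' n).1.aemeasurable.ennreal_ofReal
    · have h1 : Tendsto (fun n => ENNReal.ofReal (b (s (n + N)))) atTop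
          (𝓝 (ENNReal.ofReal (∫ x, F x ∂μ))) :=
        (ENNReal.continuous_ofReal.tendsto _).comp (hb.comp hs')
      rw [← h1.limsup_eq]
      exact limsup_le_limsup (Eventually.of_forall fun n =>
        ENNReal.ofReal_le_ofReal (hN' n).2.2)
  have := (ENNReal.tendsto_toReal ENNReal.ofReal_ne_top).comp hconv
  rw [ENNReal.toReal_ofReal (integral_nonneg hFnn)] at this
  refine this.congr fun n => ?_
  exact ENNReal.toReal_ofReal (integral_nonneg (hN' n).2.1)

/-- Dominated convergence to zero, with a dominating family that varies but converges together with
its integrals. -/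
theorem tendsto_integral_zero_of_le {α ι : Type*} [MeasurableSpace α] {μ : Measure α}
    {l : Filter ι} [l.IsCountablyGenerated] {f g : ι → α → ℝ} {F : α → ℝ}
    (hf : ∀ᶠ i in l, Integrable (f i) μ) (hg : ∀ᶠ i in l, Integrable (g i) μ)
    (hnn : ∀ᶠ i in l, ∀ x, 0 ≤ g i x) (hle : ∀ᶠ i in l, ∀ x, g i x ≤ f i x)
    (hF : Integrable F μ) (hlim : ∀ x, Tendsto (fun i => f i x) l (𝓝 (F x)))
    (hlim' : ∀ x, Tendsto (fun i => g i x) l (𝓝 0))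
    (hint : Tendsto (fun i => ∫ x, f i x ∂μ) l (𝓝 (∫ x, F x ∂μ))) :
    Tendsto (fun i => ∫ x, g i x ∂μ) l (𝓝 0) := by
  have h := tendsto_integral_of_integral_le (f := fun i x => f i x - g i x) (F := F)
    (b := fun i => ∫ x, f i x ∂μ) (by filter_upwards [hf, hg] with i h1 h2 using h1.sub h2)
    (by filter_upwards [hle] with i h x using sub_nonneg.2 (h x)) hF
    (fun x => by simpa using (hlim x).sub (hlim' x))
    (by
      filter_upwards [hf, hg, hnn] with i h1 h2 h3
      exact integral_mono (h1.sub h2) h1 fun x => sub_le_self _ (h3 x)) hint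
  have h' := hint.sub h
  rw [sub_self] at h'
  refine h'.congr' ?_
  filter_upwards [hf, hg] with i h1 h2
  rw [integral_sub h1 h2]
  ring

/-! ### Positive stable laws -/

/-- The density `α y ^ (-(α + 1)) (1 - exp (-y))`, whose integral over `(0, ∞)` is the constant in
the Laplace exponent of a sum of Pareto variables. -/
noncomputable def paretoLaplaceKernel (α y : ℝ) : ℝ := α * y ^ (-(α + 1)) * (1 - Real.exp (-y))

theorem paretoLaplaceKernel_pos {α y : ℝ} (hα : 0 < α) (hy : 0 < y) :
    0 < paretoLaplaceKernel α y := by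
  have : 0 < 1 - Real.exp (-y) := by
    have := Real.exp_lt_one_iff.2 (neg_lt_zero.2 hy)
    linarith
  unfold paretoLaplaceKernel
  positivity

theorem measurable_paretoLaplaceKernel (α : ℝ) : Measurable (paretoLaplaceKernel α) := by
  unfold paretoLaplaceKernel
  fun_prop

theorem integrableOn_paretoLaplaceKernel {α : ℝ} (hα : 0 < α) (hα' : α < 1) :
    IntegrableOn (paretoLaplaceKernel α) (Set.Ioi 0) := by
  rw [← Set.Ioc_union_Ioi_eq_Ioi zero_le_one]
  refine IntegrableOn.union ?_ ?_
  · have h1 : IntegrableOn (fun y : ℝ => α * y ^ (-α)) (Set.Ioc 0 1) := by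
      have := (intervalIntegral.intervalIntegrable_rpow' (a := 0) (b := 1)
        (show -1 < -α by linarith)).const_mul α
      rwa [intervalIntegrable_iff_integrableOn_Ioc_of_le zero_le_one] at this
    refine Integrable.mono' h1 (measurable_paretoLaplaceKernel α).aestronglyMeasurable ?_
    refine (ae_restrict_iff' measurableSet_Ioc).2 (ae_of_all _ fun y hy => ?_)
    rw [Real.norm_of_nonneg (paretoLaplaceKernel_pos hα hy.1).le, paretoLaplaceKernel]
    have e : y ^ (-α) = y ^ (-(α + 1)) * y := by
      rw [← Real.rpow_add_one hy.1.ne']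
      ring_nf
    rw [e, ← mul_assoc]
    have := Real.add_one_le_exp (-y)
    have h0 : 0 < y := hy.1
    gcongr
    linarith
  · have h1 : IntegrableOn (fun y : ℝ => α * y ^ (-(α + 1))) (Set.Ioi 1) :=
      (integrableOn_Ioi_rpow_of_lt (by linarith) one_pos).const_mul α
    refine Integrable.mono' h1 (measurable_paretoLaplaceKernel α).aestronglyMeasurable ?_
    refine (ae_restrict_iff' measurableSet_Ioi).2 (ae_of_all _ fun y hy => ?_)
    have h0 : 0 < y := zero_lt_one.trans hy
    rw [Real.norm_of_nonneg (paretoLaplaceKernel_pos hα h0).le, paretoLaplaceKernel]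
    have := Real.exp_pos (-y)
    exact mul_le_of_le_one_right (by positivity) (by linarith)

theorem integral_paretoLaplaceKernel_pos {α : ℝ} (hα : 0 < α) (hα' : α < 1) :
    0 < ∫ y in Set.Ioi 0, paretoLaplaceKernel α y := by
  rw [setIntegral_pos_iff_support_of_nonneg_ae]
  · have : Function.support (paretoLaplaceKernel α) ∩ Set.Ioi 0 = Set.Ioi 0 := by
      refine Set.inter_eq_right.2 fun y hy => (paretoLaplaceKernel_pos hα hy).ne'
    simp [this]
  · exact (ae_restrict_iff' measurableSet_Ioi).2
      (ae_of_all _ fun y hy => (paretoLaplaceKernel_pos hα hy).le)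
  · exact integrableOn_paretoLaplaceKernel hα hα'

/-- The Pareto law of index `α` on `[1, ∞)`, as a measure on `ℝ≥0`. -/
noncomputable def nnrealPareto (α : ℝ) : Measure ℝ≥0 := (paretoMeasure 1 α).map Real.toNNReal

theorem isProbabilityMeasure_nnrealPareto {α : ℝ} (hα : 0 < α) :
    IsProbabilityMeasure (nnrealPareto α) := by
  have := isProbabilityMeasure_paretoMeasure one_pos hα
  exact Measure.isProbabilityMeasure_map measurable_real_toNNReal.aemeasurable

theorem integrable_exp_neg_mul_nnreal (μ : Measure ℝ≥0) [IsFiniteMeasure μ] {l : ℝ} (hl : 0 ≤ l) :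
    Integrable (fun s : ℝ≥0 => Real.exp (-(l * s))) μ := by
  refine Integrable.of_bound (by fun_prop) 1 (ae_of_all _ fun s => ?_)
  rw [Real.norm_of_nonneg (Real.exp_pos _).le, Real.exp_le_one_iff]
  have := s.2
  simp only [Left.neg_nonpos_iff]
  positivity

/-- The Laplace transform of the Pareto law; the integral converges as `l → 0`, so that
`1 - L (l)` is asymptotic to a multiple of `l ^ α`. -/
theorem one_sub_laplace_nnrealPareto {α l : ℝ} (hα : 0 < α) (hl : 0 < l) :
    1 - ∫ s, Real.exp (-(l * s)) ∂(nnrealPareto α) =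
      l ^ α * ∫ y in Set.Ioi l, paretoLaplaceKernel α y := by
  have := isProbabilityMeasure_nnrealPareto hα
  have h1 : 1 - ∫ s, Real.exp (-(l * s)) ∂(nnrealPareto α) =
      ∫ s : ℝ≥0, (1 - Real.exp (-(l * s))) ∂(nnrealPareto α) := by
    rw [integral_sub (integrable_const _) (integrable_exp_neg_mul_nnreal _ hl.le)]
    simp
  rw [h1, nnrealPareto, integral_map measurable_real_toNNReal.aemeasurable (by fun_prop),
    paretoMeasure, integral_withDensity_eq_integral_toReal_smul (f := paretoPDF 1 α)
      (measurable_paretoPDFReal 1 α).ennreal_ofReal (ae_of_all _ fun x => ENNReal.ofReal_lt_top)]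
  have h2 : ∀ x : ℝ, (paretoPDF 1 α x).toReal • (1 - Real.exp (-(l * (Real.toNNReal x : ℝ)))) =
      (Set.Ici 1).indicator (fun x => l ^ (α + 1) * paretoLaplaceKernel α (l * x)) x := by
    intro x
    rw [paretoPDF, ENNReal.toReal_ofReal (paretoPDFReal_nonneg zero_le_one hα.le x), paretoPDFReal,
      Set.indicator_apply]
    by_cases hx : 1 ≤ x
    · have hx0 : 0 < x := by linarith
      rw [if_pos hx, if_pos (Set.mem_Ici.2 hx), Real.coe_toNNReal _ hx0.le, paretoLaplaceKernel,
        Real.mul_rpow hl.le hx0.le, Real.rpow_neg hl.le]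
      have : 0 < l ^ (α + 1) := by positivity
      simp only [Real.one_rpow, mul_one, smul_eq_mul]
      field_simp
    · rw [if_neg hx, if_neg (by simpa using hx), zero_smul]
  simp_rw [h2]
  rw [integral_indicator measurableSet_Ici, integral_Ici_eq_integral_Ioi, integral_const_mul,
    integral_comp_mul_left_Ioi _ _ hl, mul_one, Real.rpow_add_one hl.ne', smul_eq_mul]
  field_simp

theorem one_sub_laplace_nnrealPareto_le {α l : ℝ} (hα : 0 < α) (hα' : α < 1) (hl : 0 < l) :
    1 - ∫ s, Real.exp (-(l * s)) ∂(nnrealPareto α) ≤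
      l ^ α * ∫ y in Set.Ioi 0, paretoLaplaceKernel α y := by
  rw [one_sub_laplace_nnrealPareto hα hl]
  refine mul_le_mul_of_nonneg_left ?_ (by positivity)
  refine setIntegral_mono_set (integrableOn_paretoLaplaceKernel hα hα') ?_
    (Set.Ioi_subset_Ioi hl.le).eventuallyLE
  exact (ae_restrict_iff' measurableSet_Ioi).2
    (ae_of_all _ fun y hy => (paretoLaplaceKernel_pos hα hy).le)

theorem tendsto_integral_paretoLaplaceKernel {α : ℝ} (hα : 0 < α) (hα' : α < 1) {a : ℕ → ℝ}
    (ha : ∀ n, 0 < a n) (hlim : Tendsto a atTop (𝓝 0)) :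
    Tendsto (fun n => ∫ y in Set.Ioi (a n), paretoLaplaceKernel α y) atTop
      (𝓝 (∫ y in Set.Ioi 0, paretoLaplaceKernel α y)) := by
  simp_rw [← integral_indicator measurableSet_Ioi]
  have hI := (integrable_indicator_iff measurableSet_Ioi).2
    (integrableOn_paretoLaplaceKernel hα hα')
  refine tendsto_integral_of_dominated_convergence _ (fun n => ?_) hI.norm (fun n => ?_) ?_
  · exact ((measurable_paretoLaplaceKernel α).indicator measurableSet_Ioi).aestronglyMeasurable
  · refine ae_of_all _ fun y => ?_
    by_cases hy : a n < y
    · rw [Set.indicator_of_mem (Set.mem_Ioi.2 hy),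
        Set.indicator_of_mem (Set.mem_Ioi.2 ((ha n).trans hy))]
    · rw [Set.indicator_of_notMem (by simpa using hy), norm_zero]
      positivity
  · refine ae_of_all _ fun y => ?_
    by_cases hy : 0 < y
    · refine Tendsto.congr' ?_ tendsto_const_nhds
      filter_upwards [hlim.eventually (gt_mem_nhds hy)] with n hn
      rw [Set.indicator_of_mem (Set.mem_Ioi.2 hn), Set.indicator_of_mem (Set.mem_Ioi.2 hy)]
    · refine Tendsto.congr (fun n => ?_) tendsto_const_nhds
      rw [Set.indicator_of_notMem (by simpa using hy), Set.indicator_of_notMem]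
      simp only [Set.mem_Ioi, not_lt] at hy ⊢
      exact hy.trans (ha n).le

/-- A bound of the Laplace transforms near `0`, uniform over the set, implies tightness. -/
theorem isTightMeasureSet_of_laplace {S : Set (Measure ℝ≥0)} {α C : ℝ} (hα : 0 < α)
    (hS : ∀ μ ∈ S, IsProbabilityMeasure μ)
    (h : ∀ μ ∈ S, ∀ l : ℝ, 0 < l → 1 - ∫ s, Real.exp (-(l * s)) ∂μ ≤ C * l ^ α) :
    IsTightMeasureSet S := by
  rw [isTightMeasureSet_iff_exists_isCompact_measure_compl_le]
  intro ε hε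
  set d : ℝ := 1 - Real.exp (-1) with hd
  have hd0 : 0 < d := by
    have := Real.exp_lt_one_iff.2 (show (-1 : ℝ) < 0 by norm_num)
    rw [hd]
    linarith
  have hlim : Tendsto (fun M : ℝ => ENNReal.ofReal (C * (M⁻¹) ^ α / d)) atTop (𝓝 0) := by
    rw [← ENNReal.ofReal_zero]
    refine (ENNReal.continuous_ofReal.tendsto _).comp ?_
    have h1 : Tendsto (fun M : ℝ => (M⁻¹) ^ α) atTop (𝓝 0) := by
      have := (tendsto_inv_atTop_zero (𝕜 := ℝ)).rpow_const (p := α) (Or.inr hα.le)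
      rwa [Real.zero_rpow hα.ne'] at this
    simpa using (h1.const_mul C).div_const d
  obtain ⟨M, hM, hM0⟩ := ((hlim.eventually (gt_mem_nhds hε)).and (eventually_gt_atTop 0)).exists
  refine ⟨Set.Icc 0 M.toNNReal, isCompact_Icc, fun μ hμ => ?_⟩
  have := hS μ hμ
  have hint := integrable_exp_neg_mul_nnreal μ (inv_pos.2 hM0).le
  have h1 := mul_meas_ge_le_integral_of_nonneg (μ := μ)
    (f := fun s : ℝ≥0 => 1 - Real.exp (-(M⁻¹ * s)))
    (ae_of_all _ fun s => by
      have : Real.exp (-(M⁻¹ * s)) ≤ 1 := by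
        rw [Real.exp_le_one_iff, Left.neg_nonpos_iff]
        positivity
      simpa using this) ((integrable_const _).sub hint) d
  rw [integral_sub (integrable_const _) hint] at h1
  simp only [integral_const, probReal_univ, smul_eq_mul, mul_one] at h1
  have h2 : μ.real {s : ℝ≥0 | d ≤ 1 - Real.exp (-(M⁻¹ * s))} ≤ C * (M⁻¹) ^ α / d := by
    rw [le_div_iff₀ hd0, mul_comm]
    exact h1.trans (h μ hμ _ (inv_pos.2 hM0))
  refine le_trans ?_ hM.le
  calc μ (Set.Icc 0 M.toNNReal)ᶜ ≤ μ {s : ℝ≥0 | d ≤ 1 - Real.exp (-(M⁻¹ * s))} := by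
        refine measure_mono fun s hs => ?_
        have hs' : M.toNNReal < s := by
          by_contra hcon
          exact hs ⟨zero_le, not_lt.1 hcon⟩
        have hs2 : M < s := by
          rw [← NNReal.coe_lt_coe, Real.coe_toNNReal _ hM0.le] at hs'
          exact hs'
        have : 1 ≤ M⁻¹ * s := by
          rw [inv_mul_eq_div, le_div_iff₀ hM0]
          linarith
        simp only [Set.mem_ofPred_eq, hd]
        have := Real.exp_le_exp.2 (neg_le_neg this)
        linarith
    _ = ENNReal.ofReal (μ.real {s : ℝ≥0 | d ≤ 1 - Real.exp (-(M⁻¹ * s))}) :=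
        (ofReal_measureReal).symm
    _ ≤ _ := ENNReal.ofReal_le_ofReal h2

/-- The law of `(n + 1) ^ (-1 / α)` times the sum of `n + 1` independent Pareto variables (`n + 1`
instead of `n` so that the sum is never empty). -/
noncomputable def paretoSum (α : ℝ) (n : ℕ) : Measure ℝ≥0 :=
  (Measure.pi fun _ : Fin (n + 1) => nnrealPareto α).map
    fun x => ((n + 1 : ℝ≥0) ^ (-(1 / α))) * ∑ i, x i

theorem measurable_paretoSum_fun (α : ℝ) (n : ℕ) :
    Measurable fun x : Fin (n + 1) → ℝ≥0 => ((n + 1 : ℝ≥0) ^ (-(1 / α))) * ∑ i, x i := by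
  fun_prop

theorem isProbabilityMeasure_paretoSum {α : ℝ} (hα : 0 < α) (n : ℕ) :
    IsProbabilityMeasure (paretoSum α n) := by
  have := isProbabilityMeasure_nnrealPareto hα
  exact Measure.isProbabilityMeasure_map (measurable_paretoSum_fun α n).aemeasurable

theorem laplace_paretoSum {α : ℝ} (hα : 0 < α) (n : ℕ) (l : ℝ) :
    ∫ s, Real.exp (-(l * s)) ∂(paretoSum α n) =
      (∫ s, Real.exp (-(l * (n + 1 : ℝ) ^ (-(1 / α)) * s)) ∂(nnrealPareto α)) ^ (n + 1) := by
  have := isProbabilityMeasure_nnrealPareto hα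
  rw [paretoSum, integral_map (measurable_paretoSum_fun α n).aemeasurable (by fun_prop)]
  have h := integral_fintype_prod_eq_pow (ι := Fin (n + 1)) (μ := nnrealPareto α)
    (fun s : ℝ≥0 => Real.exp (-(l * (n + 1 : ℝ) ^ (-(1 / α)) * s)))
  rw [Fintype.card_fin] at h
  rw [← h]
  refine integral_congr_ae (ae_of_all _ fun x => ?_)
  simp only
  rw [← Real.exp_sum]
  congr 1
  push_cast
  rw [Finset.sum_neg_distrib, ← Finset.mul_sum, mul_assoc]

/-- The positive stable laws: the normalised Pareto sums have a limit in law, whose Laplace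
transform is `exp (-c l ^ α)`. -/
theorem exists_positiveStable {α c : ℝ} (hα : 0 < α) (hα' : α < 1) (hc : 0 < c) :
    ∃ ν : Measure ℝ≥0, IsProbabilityMeasure ν ∧
      ∀ l : ℝ, 0 ≤ l → ∫ s, Real.exp (-(l * s)) ∂ν = Real.exp (-(c * l ^ α)) := by
  set C := ∫ y in Set.Ioi 0, paretoLaplaceKernel α y with hC
  have hC0 : 0 < C := integral_paretoLaplaceKernel_pos hα hα'
  have hP := fun n => isProbabilityMeasure_paretoSum hα n
  have hscale : ∀ (n : ℕ) (l : ℝ), 0 < l → (l * (n + 1 : ℝ) ^ (-(1 / α))) ^ α =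
      l ^ α / (n + 1) := by
    intro n l hl
    rw [Real.mul_rpow hl.le (by positivity), ← Real.rpow_mul (by positivity)]
    have : -(1 / α) * α = -1 := by field_simp
    rw [this, Real.rpow_neg_one, div_eq_mul_inv]
  have hpos : ∀ (n : ℕ) (l : ℝ), 0 < l → 0 < l * (n + 1 : ℝ) ^ (-(1 / α)) := by
    intro n l hl
    positivity
  let μ : ℕ → ProbabilityMeasure ℝ≥0 := fun n => ⟨paretoSum α n, hP n⟩
  have htight : IsTightMeasureSet {((m : ProbabilityMeasure ℝ≥0) : Measure ℝ≥0) |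
      m ∈ Set.range μ} := by
    refine isTightMeasureSet_of_laplace hα (C := C) ?_ ?_
    · rintro _ ⟨m, -, rfl⟩
      infer_instance
    · rintro _ ⟨_, ⟨n, rfl⟩, rfl⟩ l hl
      change 1 - ∫ s, Real.exp (-(l * s)) ∂(paretoSum α n) ≤ _
      rw [laplace_paretoSum hα]
      set x := ∫ s, Real.exp (-(l * (n + 1 : ℝ) ^ (-(1 / α)) * s)) ∂(nnrealPareto α) with hx
      have hx0 : 0 ≤ x := integral_nonneg fun s => (Real.exp_pos _).le
      have h1 : 1 - x ≤ _ := one_sub_laplace_nnrealPareto_le hα hα' (hpos n l hl)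
      rw [hscale n l hl] at h1
      -- Bernoulli's inequality bounds the Laplace transform of the sum, uniformly in `n`
      have h2 := one_add_mul_le_pow (a := x - 1) (by linarith) (n + 1)
      push_cast at h2
      have h3 : ((n : ℝ) + 1) * (1 - x) ≤ C * l ^ α := by
        calc ((n : ℝ) + 1) * (1 - x) ≤ (n + 1) * (l ^ α / (n + 1) * C) := by gcongr
          _ = C * l ^ α := by field_simp
      rw [add_sub_cancel] at h2
      linarith
  have hcomp := isCompact_closure_of_isTightMeasureSet htight
  obtain ⟨ν, -, hν⟩ := hcomp.ultrafilter_le_nhds ((Filter.hyperfilter ℕ).map μ)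
    (by
      rw [le_principal_iff]
      exact mem_of_superset (Filter.mem_map.2 (univ_mem' fun n => Set.mem_range_self n))
        subset_closure)
  have hν' : Tendsto μ (Filter.hyperfilter ℕ) (𝓝 ν) := hν
  rw [ProbabilityMeasure.tendsto_iff_forall_integral_tendsto] at hν'
  have hL : ∀ l : ℝ, 0 < l → ∫ s, Real.exp (-(l * s)) ∂(ν : Measure ℝ≥0) =
      Real.exp (-(l ^ α * C)) := by
    intro l hl
    let φ : BoundedContinuousFunction ℝ≥0 ℝ :=
      BoundedContinuousFunction.ofNormedAddCommGroup (fun s : ℝ≥0 => Real.exp (-(l * s)))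
        (by fun_prop) 1 (fun s => by
          rw [Real.norm_of_nonneg (Real.exp_pos _).le, Real.exp_le_one_iff, Left.neg_nonpos_iff]
          positivity)
    have h1 := hν' φ
    have h2 : Tendsto (fun n => ∫ s, φ s ∂(μ n : Measure ℝ≥0)) atTop
        (𝓝 (Real.exp (-(l ^ α * C)))) := by
      change Tendsto (fun n => ∫ s, Real.exp (-(l * s)) ∂(paretoSum α n)) _ _
      simp_rw [laplace_paretoSum hα]
      set x : ℕ → ℝ := fun n =>
        ∫ s, Real.exp (-(l * (n : ℝ) ^ (-(1 / α)) * s)) ∂(nnrealPareto α) with hx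
      have hx1 : Tendsto (fun n : ℕ => (1 + (x n - 1)) ^ n) atTop
          (𝓝 (Real.exp (-(l ^ α * C)))) := by
        refine Real.tendsto_one_add_pow_exp_of_tendsto ?_
        rw [← tendsto_add_atTop_iff_nat 1]
        have h0 : Tendsto (fun n : ℕ => l * (n + 1 : ℝ) ^ (-(1 / α))) atTop (𝓝 0) := by
          have := (tendsto_rpow_neg_atTop (show 0 < 1 / α by positivity)).comp
            (tendsto_natCast_atTop_atTop (R := ℝ))
          have := ((tendsto_add_atTop_iff_nat 1).2 this).const_mul l
          simpa using this
        have h3 := ((tendsto_integral_paretoLaplaceKernel hα hα' (fun n => hpos n l hl)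
          h0).const_mul (l ^ α)).neg
        refine h3.congr fun n => ?_
        have h4 := one_sub_laplace_nnrealPareto hα (hpos n l hl)
        rw [hscale n l hl] at h4
        simp only [hx]
        push_cast
        rw [← neg_sub 1, h4]
        field_simp
      rw [← tendsto_add_atTop_iff_nat 1] at hx1
      refine hx1.congr fun n => ?_
      simp only [hx]
      push_cast
      ring
    exact tendsto_nhds_unique h1 (h2.mono_left Nat.hyperfilter_le_atTop)
  -- rescale to adjust the constant in the exponent
  set q : ℝ≥0 := (c / C).toNNReal ^ (1 / α) with hq
  have hqα : (q : ℝ) ^ α = c / C := by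
    rw [hq, NNReal.coe_rpow, Real.coe_toNNReal _ (by positivity), ← Real.rpow_mul (by positivity)]
    have : 1 / α * α = 1 := by field_simp
    rw [this, Real.rpow_one]
  have hq0 : 0 < (q : ℝ) := by
    rcases (NNReal.coe_nonneg q).eq_or_lt with h | h
    · rw [← h, Real.zero_rpow hα.ne'] at hqα
      have : 0 < c / C := by positivity
      linarith
    · exact h
  have hqm : Measurable fun s : ℝ≥0 => q * s := by fun_prop
  have hprob : IsProbabilityMeasure ((ν : Measure ℝ≥0).map fun s => q * s) :=
    Measure.isProbabilityMeasure_map hqm.aemeasurable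
  refine ⟨(ν : Measure ℝ≥0).map fun s => q * s, hprob, fun l hl => ?_⟩
  rcases hl.eq_or_lt with rfl | hl
  · simp [Real.zero_rpow hα.ne']
  rw [integral_map hqm.aemeasurable (by fun_prop)]
  have h1 := hL (l * q) (by positivity)
  rw [Real.mul_rpow hl.le hq0.le, hqα] at h1
  simp only [NNReal.coe_mul, ← mul_assoc]
  rw [h1]
  congr 2
  field_simp

/-! ### Location and scale mixtures, and the Gaussian scale mixture -/

theorem lintegral_comp_sub_div {g : ℝ → ENNReal} (hg : Measurable g) (m : ℝ) {r : ℝ}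
    (hr : 0 < r) : ∫⁻ x, g ((x - m) / r) = ENNReal.ofReal r * ∫⁻ x, g x := by
  rw [lintegral_sub_right_eq_self (fun x => g (x / r)) m]
  have h := Real.map_volume_mul_right (inv_ne_zero hr.ne')
  simp_rw [div_eq_mul_inv]
  rw [← lintegral_map (f := g) (g := fun x => x * r⁻¹) hg (by fun_prop), h, inv_inv, abs_of_pos hr,
    lintegral_smul_measure, smul_eq_mul]

/-- The law of `m + r Z`, where `(m, r)` is random and `Z` is independent of it with density `q`,
has the density `E (q ((x - m) / r) / r)`. -/
theorem map_locationScale_eq_withDensity {K : Type*} [MeasurableSpace K] {κ : Measure K}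
    [SFinite κ] {m r : K → ℝ} (hm : Measurable m) (hr : Measurable r) (hpos : ∀ᵐ k ∂κ, 0 < r k)
    {q : ℝ → ℝ} (hq : Measurable q) (hq0 : ∀ x, 0 ≤ q x)
    (hint : ∀ x, Integrable (fun k => (r k)⁻¹ * q ((x - m k) / r k)) κ) :
    (κ.prod (volume.withDensity fun x => ENNReal.ofReal (q x))).map
        (fun p => m p.1 + r p.1 * p.2) =
      volume.withDensity fun x => ENNReal.ofReal (∫ k, (r k)⁻¹ * q ((x - m k) / r k) ∂κ) := by
  ext B hB
  have hmeas : Measurable fun p : K × ℝ => m p.1 + r p.1 * p.2 := by fun_prop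
  have hk : ∀ᵐ k ∂κ, (volume.withDensity fun x => ENNReal.ofReal (q x))
      (Prod.mk k ⁻¹' ((fun p : K × ℝ => m p.1 + r p.1 * p.2) ⁻¹' B)) =
      ∫⁻ x in B, ENNReal.ofReal ((r k)⁻¹ * q ((x - m k) / r k)) := by
    filter_upwards [hpos] with k hk
    have hB' : MeasurableSet (Prod.mk k ⁻¹' ((fun p : K × ℝ => m p.1 + r p.1 * p.2) ⁻¹' B)) :=
      measurable_prodMk_left (hmeas hB)
    rw [withDensity_apply _ hB', ← lintegral_indicator hB', ← lintegral_indicator hB]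
    have h1 : ∀ x, B.indicator (fun x => ENNReal.ofReal ((r k)⁻¹ * q ((x - m k) / r k))) x =
        ENNReal.ofReal (r k)⁻¹ *
          (Prod.mk k ⁻¹' ((fun p : K × ℝ => m p.1 + r p.1 * p.2) ⁻¹' B)).indicator
            (fun x => ENNReal.ofReal (q x)) ((x - m k) / r k) := by
      classical
      intro x
      have hx : m k + r k * ((x - m k) / r k) = x := by field_simp; ring
      simp only [Set.indicator_apply, Set.mem_preimage, hx]
      split_ifs
      · rw [ENNReal.ofReal_mul (inv_pos.2 hk).le]
      · rw [mul_zero]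
    rw [lintegral_congr h1]
    have h2 := lintegral_comp_sub_div ((hq.ennreal_ofReal).indicator hB') (m k) hk
    have h3 : Measurable fun x => (Prod.mk k ⁻¹' ((fun p : K × ℝ => m p.1 + r p.1 * p.2) ⁻¹'
        B)).indicator (fun x => ENNReal.ofReal (q x)) ((x - m k) / r k) :=
      ((hq.ennreal_ofReal).indicator hB').comp (by fun_prop)
    rw [lintegral_const_mul _ h3, h2, ← mul_assoc, ← ENNReal.ofReal_mul (inv_pos.2 hk).le,
      inv_mul_cancel₀ hk.ne', ENNReal.ofReal_one, one_mul]
  rw [Measure.map_apply hmeas hB, Measure.prod_apply (hmeas hB), lintegral_congr_ae hk,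
    withDensity_apply _ hB, lintegral_lintegral_swap]
  · refine lintegral_congr fun x => ?_
    refine (ofReal_integral_eq_lintegral_ofReal (hint x) ?_).symm
    filter_upwards [hpos] with k hk
    exact mul_nonneg (inv_pos.2 hk).le (hq0 _)
  · exact Measurable.aemeasurable (by fun_prop)

/-- The transformation rule of the Fisher informations under changes of location and scale. -/
theorem lintegral_ofReal_sq_div_locationScale {A q : ℝ → ℝ} (hA : Measurable A) (hq : Measurable q)
    (c m : ℝ) {r : ℝ} (hr : 0 < r) :
    ∫⁻ x, ENNReal.ofReal ((c * (r⁻¹ * A ((x - m) / r))) ^ 2 / (r⁻¹ * q ((x - m) / r))) =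
      ENNReal.ofReal (c ^ 2) * ∫⁻ x, ENNReal.ofReal (A x ^ 2 / q x) := by
  have h1 : ∀ x, ENNReal.ofReal ((c * (r⁻¹ * A ((x - m) / r))) ^ 2 / (r⁻¹ * q ((x - m) / r))) =
      ENNReal.ofReal (c ^ 2) * (ENNReal.ofReal r⁻¹ *
        (fun y => ENNReal.ofReal (A y ^ 2 / q y)) ((x - m) / r)) := by
    intro x
    have hr' := inv_pos.2 hr
    rw [← ENNReal.ofReal_mul hr'.le, ← ENNReal.ofReal_mul (sq_nonneg c)]
    congr 1
    rcases eq_or_ne (q ((x - m) / r)) 0 with h | h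
    · simp [h]
    · field_simp
  have h2 : Measurable fun y => ENNReal.ofReal (A y ^ 2 / q y) :=
    ((hA.pow_const 2).div hq).ennreal_ofReal
  have h3 : Measurable fun x => (fun y => ENNReal.ofReal (A y ^ 2 / q y)) ((x - m) / r) :=
    h2.comp (by fun_prop)
  simp_rw [h1]
  rw [lintegral_const_mul _ (h3.const_mul _), lintegral_const_mul _ h3,
    lintegral_comp_sub_div h2 m hr, ← mul_assoc (ENNReal.ofReal r⁻¹),
    ← ENNReal.ofReal_mul (inv_pos.2 hr).le, inv_mul_cancel₀ hr.ne', ENNReal.ofReal_one, one_mul]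

theorem integrable_exp_neg_mul_abs_rpow {b p : ℝ} (hb : 0 < b) (hp : 0 < p) (n : ℕ) :
    Integrable fun u : ℝ => |u| ^ n * Real.exp (-(b * |u| ^ p)) := by
  refine Integrable.of_integral_ne_zero ?_
  have hn : (-1 : ℝ) < n := by linarith [n.cast_nonneg (α := ℝ)]
  have h := integral_rpow_mul_exp_neg_mul_rpow hp hn hb
  simp only [Real.rpow_natCast, neg_mul] at h
  rw [integral_comp_abs (f := fun u : ℝ => u ^ n * Real.exp (-(b * u ^ p))), h]
  have : 0 < Real.Gamma (((n : ℝ) + 1) / p) := Real.Gamma_pos_of_pos (by positivity)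
  positivity

/-- A positive variable whose Laplace transform is `exp (-c l ^ α)` has no mass at zero, and its
inverse is integrable. -/
theorem integrable_inv_of_laplace {ν : Measure ℝ≥0} [IsProbabilityMeasure ν] {α c : ℝ}
    (hα : 0 < α) (hc : 0 < c)
    (h : ∀ l : ℝ, 0 ≤ l → ∫ s, Real.exp (-(l * s)) ∂ν = Real.exp (-(c * l ^ α))) :
    (∀ᵐ s ∂ν, 0 < s) ∧ Integrable (fun s : ℝ≥0 => (s : ℝ)⁻¹) ν := by
  have hI : IntegrableOn (fun l : ℝ => Real.exp (-(c * l ^ α))) (Set.Ioi 0) := by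
    have h1 := integral_exp_neg_mul_rpow hα hc
    simp only [neg_mul] at h1
    refine Integrable.of_integral_ne_zero ?_
    rw [h1]
    have : 0 < Real.Gamma (1 / α + 1) := Real.Gamma_pos_of_pos (by positivity)
    positivity
  have hswap : ∫⁻ s, (∫⁻ l in Set.Ioi (0 : ℝ), ENNReal.ofReal (Real.exp (-(l * s)))) ∂ν =
      ∫⁻ l in Set.Ioi (0 : ℝ), ENNReal.ofReal (Real.exp (-(c * l ^ α))) := by
    rw [lintegral_lintegral_swap (Measurable.aemeasurable (by fun_prop))]
    refine setLIntegral_congr_fun measurableSet_Ioi fun l hl => ?_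
    have hl' : (0 : ℝ) ≤ l := (Set.mem_Ioi.1 hl).le
    rw [← ofReal_integral_eq_lintegral_ofReal (integrable_exp_neg_mul_nnreal ν hl')
      (ae_of_all _ fun s => (Real.exp_pos _).le), h l hl']
  have hfin : ∫⁻ s, (∫⁻ l in Set.Ioi (0 : ℝ), ENNReal.ofReal (Real.exp (-(l * s)))) ∂ν < ⊤ := by
    rw [hswap]
    exact hI.lintegral_lt_top
  have hpos : ∀ᵐ s ∂ν, 0 < s := by
    have h1 := ae_lt_top' (Measurable.aemeasurable (by fun_prop)) hfin.ne
    filter_upwards [h1] with s hs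
    refine pos_iff_ne_zero.2 fun h0 => ?_
    simp [h0] at hs
  refine ⟨hpos, (by fun_prop : Measurable fun s : ℝ≥0 => (s : ℝ)⁻¹).aestronglyMeasurable, ?_⟩
  rw [hasFiniteIntegral_iff_ofReal (ae_of_all _ fun s => by simp)]
  refine lt_of_le_of_lt (lintegral_mono_ae ?_) hfin
  filter_upwards [hpos] with s hs
  have hs' : (0 : ℝ) < s := hs
  have h1 : IntegrableOn (fun l : ℝ => Real.exp (-(l * s))) (Set.Ioi 0) := by
    have := exp_neg_integrableOn_Ioi 0 hs'
    simpa [mul_comm] using this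
  rw [← ofReal_integral_eq_lintegral_ofReal h1 (ae_of_all _ fun s => (Real.exp_pos _).le)]
  have h2 := integral_exp_mul_Ioi (a := -(s : ℝ)) (by linarith) 0
  have h3 : ∫ l in Set.Ioi (0 : ℝ), Real.exp (-(l * s)) = (s : ℝ)⁻¹ := by
    rw [← inv_inv (s : ℝ)]
    simp only [mul_zero, Real.exp_zero] at h2
    rw [show (fun l : ℝ => Real.exp (-(l * (s : ℝ)⁻¹⁻¹))) = fun l => Real.exp (-(s : ℝ) * l) by
      ext l; congr 1; rw [inv_inv]; ring, h2]
    rw [inv_inv, neg_div_neg_eq, one_div]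
  rw [h3]

/-- The symmetric stable law is a mixture of centred Gaussian laws; `ρ` is the law of the standard
deviation. -/
structure IsGaussianScaleMixture (β : ℝ) (ρ : Measure ℝ) : Prop where
  prob : IsProbabilityMeasure ρ
  pos : ∀ᵐ r ∂ρ, 0 < r
  integrable_inv_sq : Integrable (fun r : ℝ => (r ^ 2)⁻¹) ρ
  charFun_eq : ∀ u : ℝ, ∫ r, Real.exp (-(r ^ 2 * u ^ 2 / 2)) ∂ρ = Real.exp (-(|u| ^ β / 2))

theorem exists_isGaussianScaleMixture {β : ℝ} (hβ : 0 < β) (hβ' : β ≤ 2) :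
    ∃ ρ, IsGaussianScaleMixture β ρ := by
  rcases hβ'.eq_or_lt with rfl | hlt
  · refine ⟨Measure.dirac 1, inferInstance, ?_, ?_, fun u => ?_⟩
    · rw [ae_dirac_eq]
      simp
    · exact integrable_dirac (by simp)
    · simp [integral_dirac]
  · have hα : 0 < β / 2 := by positivity
    have hc : 0 < (2 : ℝ) ^ (β / 2 - 1) := by positivity
    obtain ⟨ν, hν, hL⟩ := exists_positiveStable hα (by linarith) hc
    obtain ⟨h1, h2⟩ := integrable_inv_of_laplace hα hc hL
    have hm : Measurable fun s : ℝ≥0 => √(s : ℝ) := by fun_prop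
    refine ⟨ν.map fun s : ℝ≥0 => √(s : ℝ), Measure.isProbabilityMeasure_map hm.aemeasurable, ?_, ?_,
      fun u => ?_⟩
    · rw [ae_map_iff hm.aemeasurable measurableSet_Ioi]
      filter_upwards [h1] with s hs
      exact Real.sqrt_pos.2 hs
    · rw [integrable_map_measure (by fun_prop) hm.aemeasurable]
      refine h2.congr (ae_of_all _ fun s => ?_)
      simp
    · rw [integral_map hm.aemeasurable (by fun_prop)]
      have h3 := hL (u ^ 2 / 2) (by positivity)
      have h4 : (2 : ℝ) ^ (β / 2 - 1) * (u ^ 2 / 2) ^ (β / 2) = |u| ^ β / 2 := by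
        rw [Real.div_rpow (sq_nonneg u) zero_le_two, ← sq_abs, ← Real.rpow_natCast,
          ← Real.rpow_mul (abs_nonneg u), Real.rpow_sub_one two_ne_zero]
        have : ((2 : ℕ) : ℝ) * (β / 2) = β := by push_cast; ring
        rw [this]
        have : 0 < (2 : ℝ) ^ (β / 2) := by positivity
        field_simp
      rw [h4] at h3
      rw [← h3]
      refine integral_congr_ae (ae_of_all _ fun s => ?_)
      have hs : √(s : ℝ) ^ 2 = s := Real.sq_sqrt s.2
      simp only [hs]
      congr 1
      ring

/-! ### The stable density as a mixture of Gaussian densities -/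

theorem gaussianPDFReal_std (x : ℝ) :
    gaussianPDFReal 0 1 x = (√(2 * Real.pi))⁻¹ * Real.exp (-(x ^ 2 / 2)) := by
  simp [gaussianPDFReal, neg_div]

theorem hasDerivAt_gaussianPDFReal_std (x : ℝ) :
    HasDerivAt (gaussianPDFReal 0 1) (-x * gaussianPDFReal 0 1 x) x := by
  have h1 : gaussianPDFReal 0 1 = fun x => (√(2 * Real.pi))⁻¹ * Real.exp (-(x ^ 2 / 2)) :=
    funext gaussianPDFReal_std
  have h2 : HasDerivAt (fun x : ℝ => -(x ^ 2 / 2)) (-x) x := by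
    have := ((hasDerivAt_pow 2 x).div_const 2).neg
    convert! this using 1
    simp
  rw [gaussianPDFReal_std, h1]
  convert! (h2.exp.const_mul (√(2 * Real.pi))⁻¹) using 1
  ring

/-- A single bound from which those of `φ`, `x φ` and `x ^ 2 φ` follow. -/
theorem gaussianPDFReal_std_le (x : ℝ) : (1 + x ^ 2 / 2) * gaussianPDFReal 0 1 x ≤ 1 := by
  rw [gaussianPDFReal_std]
  have h1 : 1 ≤ √(2 * Real.pi) := by
    rw [Real.one_le_sqrt]
    linarith [Real.pi_gt_three]
  have h2 : (√(2 * Real.pi))⁻¹ ≤ 1 := inv_le_one_of_one_le₀ h1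
  have h3 : (1 + x ^ 2 / 2) * Real.exp (-(x ^ 2 / 2)) ≤ 1 := by
    rw [Real.exp_neg, ← div_eq_mul_inv, div_le_one (Real.exp_pos _)]
    linarith [Real.add_one_le_exp (x ^ 2 / 2)]
  calc (1 + x ^ 2 / 2) * ((√(2 * Real.pi))⁻¹ * Real.exp (-(x ^ 2 / 2)))
      = (√(2 * Real.pi))⁻¹ * ((1 + x ^ 2 / 2) * Real.exp (-(x ^ 2 / 2))) := by ring
    _ ≤ 1 * 1 := by gcongr
    _ = 1 := one_mul 1

theorem gaussianPDFReal_std_pos (x : ℝ) : 0 < gaussianPDFReal 0 1 x :=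
  gaussianPDFReal_pos 0 1 x one_ne_zero

theorem gaussianPDFReal_std_le_one (x : ℝ) : gaussianPDFReal 0 1 x ≤ 1 := by
  have h1 := gaussianPDFReal_std_le x
  have h2 := gaussianPDFReal_std_pos x
  nlinarith [mul_nonneg (sq_nonneg x) h2.le]

theorem abs_neg_mul_gaussianPDFReal_std_le (x : ℝ) : |-x * gaussianPDFReal 0 1 x| ≤ 1 := by
  have h1 := gaussianPDFReal_std_le x
  have h2 := gaussianPDFReal_std_pos x
  rw [abs_mul, abs_neg, abs_of_pos h2]
  have : |x| ≤ 1 + x ^ 2 / 2 := by nlinarith [sq_nonneg (|x| - 1), sq_abs x]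
  nlinarith

theorem abs_mul_neg_mul_gaussianPDFReal_std_le (x : ℝ) :
    |x * (-x * gaussianPDFReal 0 1 x)| ≤ 2 := by
  have h1 := gaussianPDFReal_std_le x
  have h2 := gaussianPDFReal_std_pos x
  have : x * (-x * gaussianPDFReal 0 1 x) = -(x ^ 2 * gaussianPDFReal 0 1 x) := by ring
  rw [this, abs_neg, abs_of_nonneg (by positivity)]
  nlinarith

theorem integrable_pow_mul_gaussianPDFReal_std (n : ℕ) :
    Integrable fun x : ℝ => |x| ^ n * gaussianPDFReal 0 1 x := by
  have h := (integrable_exp_neg_mul_abs_rpow (b := 1 / 2) (p := 2) (by norm_num) (by norm_num)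
    n).const_mul (√(2 * Real.pi))⁻¹
  refine h.congr (ae_of_all _ fun x => ?_)
  simp only [gaussianPDFReal_std, Real.rpow_ofNat, sq_abs]
  ring_nf

theorem lintegral_gaussian_translation_lt_top :
    ∫⁻ x, ENNReal.ofReal ((-x * gaussianPDFReal 0 1 x) ^ 2 / gaussianPDFReal 0 1 x) < ⊤ := by
  have h := (integrable_pow_mul_gaussianPDFReal_std 2).lintegral_lt_top
  refine lt_of_le_of_lt (lintegral_mono fun x => ENNReal.ofReal_le_ofReal (le_of_eq ?_)) h
  have := gaussianPDFReal_std_pos x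
  rw [sq_abs]
  field_simp

theorem lintegral_gaussian_scale_lt_top :
    ∫⁻ x, ENNReal.ofReal ((gaussianPDFReal 0 1 x + x * (-x * gaussianPDFReal 0 1 x)) ^ 2 /
      gaussianPDFReal 0 1 x) < ⊤ := by
  have h := (((integrable_pow_mul_gaussianPDFReal_std 0).const_mul 2).add
    ((integrable_pow_mul_gaussianPDFReal_std 4).const_mul 2)).lintegral_lt_top
  refine lt_of_le_of_lt (lintegral_mono fun x => ENNReal.ofReal_le_ofReal ?_) h
  have hp := gaussianPDFReal_std_pos x
  have e : (gaussianPDFReal 0 1 x + x * (-x * gaussianPDFReal 0 1 x)) ^ 2 /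
      gaussianPDFReal 0 1 x = (1 - x ^ 2) ^ 2 * gaussianPDFReal 0 1 x := by
    field_simp
    ring
  have e4 : |x| ^ 4 = x ^ 4 := by
    rw [show (4 : ℕ) = 2 * 2 from rfl, pow_mul, sq_abs, ← pow_mul]
  simp only [Pi.add_apply]
  rw [e, e4]
  have : (1 - x ^ 2) ^ 2 ≤ 2 + 2 * x ^ 4 := by nlinarith [sq_nonneg (1 + x ^ 2)]
  nlinarith

theorem integral_cos_mul_gaussianPDFReal_std (t : ℝ) :
    ∫ z, Real.cos (t * z) * gaussianPDFReal 0 1 z = Real.exp (-(t ^ 2 / 2)) := by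
  have h := charFun_gaussianReal (μ := 0) (v := 1) t
  rw [charFun_apply_real, integral_gaussianReal_eq_integral_smul one_ne_zero] at h
  have hre := congrArg Complex.re h
  have hint : Integrable fun z : ℝ =>
      gaussianPDFReal 0 1 z • Complex.exp (t * z * Complex.I) := by
    refine (integrable_gaussianPDFReal 0 1).mono' (by fun_prop) (ae_of_all _ fun z => ?_)
    rw [norm_smul, ← Complex.ofReal_mul, Complex.norm_exp_ofReal_mul_I, mul_one,
      Real.norm_of_nonneg (gaussianPDFReal_std_pos z).le]
  rw [← Complex.reCLM_apply, ← ContinuousLinearMap.integral_comp_comm _ hint] at hre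
  have e1 : ∀ z : ℝ, Complex.reCLM (gaussianPDFReal 0 1 z • Complex.exp (t * z * Complex.I)) =
      Real.cos (t * z) * gaussianPDFReal 0 1 z := by
    intro z
    rw [map_smul, Complex.reCLM_apply, ← Complex.ofReal_mul, Complex.exp_ofReal_mul_I_re,
      smul_eq_mul, mul_comm]
  simp_rw [e1] at hre
  rw [hre]
  have e2 : (t : ℂ) * ((0 : ℝ) : ℂ) * Complex.I - ((1 : ℝ≥0) : ℂ) * (t : ℂ) ^ 2 / 2 =
      ((-(t ^ 2 / 2) : ℝ) : ℂ) := by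
    push_cast
    ring
  rw [e2, Complex.exp_ofReal_re]

theorem integral_cos_mul_exp_neg_sq {r : ℝ} (hr : 0 < r) (w : ℝ) :
    ∫ u, Real.cos (u * w) * Real.exp (-(r ^ 2 * u ^ 2 / 2)) =
      2 * Real.pi * (r⁻¹ * gaussianPDFReal 0 1 (w / r)) := by
  have h1 := Measure.integral_comp_mul_left
    (fun z => Real.cos (w / r * z) * gaussianPDFReal 0 1 z) r
  rw [integral_cos_mul_gaussianPDFReal_std, abs_of_pos (inv_pos.2 hr), smul_eq_mul] at h1
  have h2 : 0 < √(2 * Real.pi) := by positivity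
  have e : ∀ u : ℝ, Real.cos (u * w) * Real.exp (-(r ^ 2 * u ^ 2 / 2)) =
      √(2 * Real.pi) * (Real.cos (w / r * (r * u)) * gaussianPDFReal 0 1 (r * u)) := by
    intro u
    rw [gaussianPDFReal_std]
    have e1 : w / r * (r * u) = u * w := by field_simp
    rw [e1, mul_pow]
    field_simp
  simp_rw [e]
  rw [integral_const_mul, h1, gaussianPDFReal_std]
  have h3 : 2 * Real.pi = √(2 * Real.pi) * √(2 * Real.pi) :=
    (Real.mul_self_sqrt (by positivity)).symm
  rw [h3]
  simp only [Real.sqrt_mul_self h2.le]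
  field_simp

namespace IsGaussianScaleMixture

variable {β : ℝ} {ρ : Measure ℝ}

theorem integrable_inv (H : IsGaussianScaleMixture β ρ) : Integrable (fun r : ℝ => r⁻¹) ρ := by
  have := H.prob
  refine ((integrable_const (1 : ℝ)).add H.integrable_inv_sq).mono' (by fun_prop) ?_
  filter_upwards [H.pos] with r hr
  rw [Real.norm_of_nonneg (inv_pos.2 hr).le, Pi.add_apply, ← inv_pow]
  nlinarith [sq_nonneg (r⁻¹ - 1), inv_pos.2 hr]

theorem integrable_density (H : IsGaussianScaleMixture β ρ) (x : ℝ) :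
    Integrable (fun r => r⁻¹ * gaussianPDFReal 0 1 (x / r)) ρ := by
  refine H.integrable_inv.mono' (by fun_prop) ?_
  filter_upwards [H.pos] with r hr
  have h := gaussianPDFReal_std_pos (x / r)
  have hr' := inv_pos.2 hr
  rw [Real.norm_of_nonneg (by positivity)]
  exact mul_le_of_le_one_right hr'.le (gaussianPDFReal_std_le_one _)

/-- Fourier inversion, componentwise. -/
theorem stableDensity_eq (H : IsGaussianScaleMixture β ρ) (x : ℝ) :
    stableDensity β x = ∫ r, r⁻¹ * gaussianPDFReal 0 1 (x / r) ∂ρ := by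
  have := H.prob
  have hg : ∀ r : ℝ, 0 < r → Integrable fun u : ℝ => Real.exp (-(r ^ 2 * u ^ 2 / 2)) := by
    intro r hr
    have := integrable_exp_neg_mul_sq (show 0 < r ^ 2 / 2 by positivity)
    refine this.congr (ae_of_all _ fun u => ?_)
    ring_nf
  have h1 : Integrable (fun p : ℝ × ℝ => Real.exp (-(p.1 ^ 2 * p.2 ^ 2 / 2)))
      (ρ.prod volume) := by
    rw [integrable_prod_iff (by fun_prop)]
    refine ⟨?_, ?_⟩
    · filter_upwards [H.pos] with r hr using hg r hr
    · refine ((H.integrable_density 0).const_mul (2 * Real.pi)).congr ?_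
      filter_upwards [H.pos] with r hr
      rw [← integral_cos_mul_exp_neg_sq hr 0]
      simp [abs_of_pos (Real.exp_pos _)]
  have h2 : Integrable (fun p : ℝ × ℝ => Real.cos (p.2 * x) *
      Real.exp (-(p.1 ^ 2 * p.2 ^ 2 / 2))) (ρ.prod volume) := by
    refine h1.mono' (by fun_prop) (ae_of_all _ fun p => ?_)
    rw [norm_mul, Real.norm_of_nonneg (Real.exp_pos _).le]
    exact mul_le_of_le_one_left (Real.exp_pos _).le (Real.abs_cos_le_one _)
  have h3 : ∫ u, Real.cos (u * x) * Real.exp (-(|u| ^ β / 2)) =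
      ∫ r, 2 * Real.pi * (r⁻¹ * gaussianPDFReal 0 1 (x / r)) ∂ρ := by
    simp_rw [← H.charFun_eq, ← integral_const_mul]
    rw [← integral_integral_swap h2]
    refine integral_congr_ae ?_
    filter_upwards [H.pos] with r hr using integral_cos_mul_exp_neg_sq hr x
  rw [stableDensity, h3, integral_const_mul]
  have := Real.pi_pos
  field_simp

/-- Differentiation of the stable density under the integral over the Gaussian components. -/
theorem hasDerivAt_stableDensity (H : IsGaussianScaleMixture β ρ) (x : ℝ) :
    Integrable (fun r => r⁻¹ * (r⁻¹ * (-(x / r) * gaussianPDFReal 0 1 (x / r)))) ρ ∧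
    HasDerivAt (stableDensity β)
      (∫ r, r⁻¹ * (r⁻¹ * (-(x / r) * gaussianPDFReal 0 1 (x / r))) ∂ρ) x := by
  rw [funext H.stableDensity_eq]
  refine hasDerivAt_integral_of_dominated_loc_of_deriv_le (s := Set.univ)
    (F := fun x r => r⁻¹ * gaussianPDFReal 0 1 (x / r))
    (F' := fun x r => r⁻¹ * (r⁻¹ * (-(x / r) * gaussianPDFReal 0 1 (x / r))))
    (bound := fun r => (r ^ 2)⁻¹) univ_mem
    (Eventually.of_forall fun y => (H.integrable_density y).1) (H.integrable_density x)
    (by fun_prop) ?_ H.integrable_inv_sq ?_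
  · filter_upwards [H.pos] with r hr y _
    rw [← mul_assoc, norm_mul, Real.norm_of_nonneg (by positivity), ← mul_inv, ← sq]
    exact mul_le_of_le_one_right (by positivity) (abs_neg_mul_gaussianPDFReal_std_le _)
  · filter_upwards [H.pos] with r hr y _
    have h := (hasDerivAt_gaussianPDFReal_std (y / r)).comp y ((hasDerivAt_id y).div_const r)
    convert! h.const_mul r⁻¹ using 1
    ring

theorem deriv_eq (H : IsGaussianScaleMixture β ρ) (x : ℝ) :
    deriv (stableDensity β) x =
      ∫ r, r⁻¹ * (r⁻¹ * (-(x / r) * gaussianPDFReal 0 1 (x / r))) ∂ρ :=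
  (H.hasDerivAt_stableDensity x).2.deriv

theorem stableDensity_add_mul_deriv_eq (H : IsGaussianScaleMixture β ρ) (x : ℝ) :
    Integrable (fun r => r⁻¹ * (gaussianPDFReal 0 1 (x / r) +
      x / r * (-(x / r) * gaussianPDFReal 0 1 (x / r)))) ρ ∧
    stableDensity β x + x * deriv (stableDensity β) x =
      ∫ r, r⁻¹ * (gaussianPDFReal 0 1 (x / r) +
        x / r * (-(x / r) * gaussianPDFReal 0 1 (x / r))) ∂ρ := by
  have h1 := H.integrable_density x
  have h2 := (H.hasDerivAt_stableDensity x).1.const_mul x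
  have e : ∀ r : ℝ, r⁻¹ * gaussianPDFReal 0 1 (x / r) +
      x * (r⁻¹ * (r⁻¹ * (-(x / r) * gaussianPDFReal 0 1 (x / r)))) =
      r⁻¹ * (gaussianPDFReal 0 1 (x / r) +
        x / r * (-(x / r) * gaussianPDFReal 0 1 (x / r))) := by
    intro r
    ring
  refine ⟨(h1.add h2).congr (ae_of_all _ e), ?_⟩
  rw [H.stableDensity_eq, H.deriv_eq, ← integral_const_mul, ← integral_add h1 h2]
  exact integral_congr_ae (ae_of_all _ e)

theorem stableDensity_pos (H : IsGaussianScaleMixture β ρ) (x : ℝ) : 0 < stableDensity β x := by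
  have := H.prob
  have hp : ∀ᵐ r ∂ρ, 0 < r⁻¹ * gaussianPDFReal 0 1 (x / r) := by
    filter_upwards [H.pos] with r hr
    exact mul_pos (inv_pos.2 hr) (gaussianPDFReal_std_pos _)
  rw [H.stableDensity_eq, integral_pos_iff_support_of_nonneg_ae
    (hp.mono fun r hr => hr.le) (H.integrable_density x)]
  have h1 : ρ (Function.support fun r => r⁻¹ * gaussianPDFReal 0 1 (x / r)) = 1 := by
    rw [← measure_univ (μ := ρ)]
    refine measure_congr (eventuallyEq_univ.2 ?_)
    filter_upwards [hp] with r hr using hr.ne'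
  rw [h1]
  exact one_pos

theorem stableDensity_le_of_abs_le (H : IsGaussianScaleMixture β ρ) {x y : ℝ} (h : |x| ≤ |y|) :
    stableDensity β y ≤ stableDensity β x := by
  rw [H.stableDensity_eq, H.stableDensity_eq]
  refine integral_mono_ae (H.integrable_density y) (H.integrable_density x) ?_
  filter_upwards [H.pos] with r hr
  have h2 : x ^ 2 ≤ y ^ 2 := sq_le_sq.2 h
  simp only [gaussianPDFReal_std, div_pow]
  gcongr

theorem abs_deriv_le (H : IsGaussianScaleMixture β ρ) (x : ℝ) :
    |deriv (stableDensity β) x| ≤ ∫ r, (r ^ 2)⁻¹ ∂ρ := by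
  rw [H.deriv_eq, ← Real.norm_eq_abs]
  refine norm_integral_le_of_norm_le H.integrable_inv_sq ?_
  filter_upwards [H.pos] with r hr
  rw [← mul_assoc, norm_mul, Real.norm_of_nonneg (by positivity), ← mul_inv, ← sq]
  exact mul_le_of_le_one_right (by positivity) (abs_neg_mul_gaussianPDFReal_std_le _)

theorem abs_stableDensity_add_mul_deriv_le (H : IsGaussianScaleMixture β ρ) (x : ℝ) :
    |stableDensity β x + x * deriv (stableDensity β) x| ≤ ∫ r, r⁻¹ * 3 ∂ρ := by
  rw [(H.stableDensity_add_mul_deriv_eq x).2, ← Real.norm_eq_abs]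
  refine norm_integral_le_of_norm_le (H.integrable_inv.mul_const 3) ?_
  filter_upwards [H.pos] with r hr
  rw [norm_mul, Real.norm_of_nonneg (inv_pos.2 hr).le]
  refine mul_le_mul_of_nonneg_left ((norm_add_le _ _).trans ?_) (inv_pos.2 hr).le
  have h1 : ‖gaussianPDFReal 0 1 (x / r)‖ ≤ 1 := by
    rw [Real.norm_of_nonneg (gaussianPDFReal_std_pos _).le]
    exact gaussianPDFReal_std_le_one _
  have h2 : ‖x / r * (-(x / r) * gaussianPDFReal 0 1 (x / r))‖ ≤ 2 :=
    abs_mul_neg_mul_gaussianPDFReal_std_le _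
  linarith

end IsGaussianScaleMixture

/-! ### Law, tail and informations of the stable density -/

theorem contDiff_stableDensity {β : ℝ} (hβ : 0 < β) : ContDiff ℝ (⊤ : ℕ∞) (stableDensity β) := by
  have hF : ContDiff ℝ ((⊤ : ℕ∞) : WithTop ℕ∞)
      (FourierTransform.fourier fun u : ℝ => ((Real.exp (-(|u| ^ β / 2)) : ℝ) : ℂ)) := by
    refine Real.contDiff_fourier fun n _ => ?_
    have h := integrable_exp_neg_mul_abs_rpow (show (0 : ℝ) < 1 / 2 by norm_num) hβ n
    refine h.congr (ae_of_all _ fun u => ?_)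
    simp only [Real.norm_eq_abs, Complex.norm_real, Real.abs_exp]
    ring_nf
  have hint : Integrable fun u : ℝ => Real.exp (-(|u| ^ β / 2)) := by
    have h := integrable_exp_neg_mul_abs_rpow (show (0 : ℝ) < 1 / 2 by norm_num) hβ 0
    refine h.congr (ae_of_all _ fun u => ?_)
    simp only [pow_zero, one_mul]
    ring_nf
  have e : stableDensity β = fun w => (2 * Real.pi)⁻¹ * Complex.reCLM
      (FourierTransform.fourier (fun u : ℝ => ((Real.exp (-(|u| ^ β / 2)) : ℝ) : ℂ))
        (w * (2 * Real.pi)⁻¹)) := by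
    ext w
    rw [stableDensity, Real.fourier_real_eq_integral_exp_smul,
      ← ContinuousLinearMap.integral_comp_comm]
    · congr 1
      refine integral_congr_ae (ae_of_all _ fun u => ?_)
      have := Real.pi_pos
      simp only [Complex.reCLM_apply, smul_eq_mul]
      rw [Complex.re_mul_ofReal, Complex.exp_ofReal_mul_I_re, ← Real.cos_neg]
      congr 2
      field_simp
    · refine hint.mono (by fun_prop) (ae_of_all _ fun u => ?_)
      rw [norm_smul, Complex.norm_exp_ofReal_mul_I, one_mul, Complex.norm_real]
  rw [e]
  exact contDiff_const.mul (Complex.reCLM.contDiff.comp (hF.comp (contDiff_id.mul contDiff_const)))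

namespace IsGaussianScaleMixture

variable {β : ℝ} {ρ : Measure ℝ}

theorem continuous_stableDensity (H : IsGaussianScaleMixture β ρ) :
    Continuous (stableDensity β) :=
  continuous_iff_continuousAt.2 fun x => (H.hasDerivAt_stableDensity x).2.continuousAt

/-- The stable law, built as the law of the product of an independent scale and a standard Gaussian
variable, has the density `stableDensity`. -/
theorem map_mul_eq (H : IsGaussianScaleMixture β ρ) :
    (ρ.prod (gaussianReal 0 1)).map (fun p => p.1 * p.2) =
      volume.withDensity fun x => ENNReal.ofReal (stableDensity β x) := by
  have := H.prob
  have h := map_locationScale_eq_withDensity (κ := ρ) (m := fun _ => 0) (r := fun r => r)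
    measurable_const measurable_id H.pos (measurable_gaussianPDFReal 0 1)
    (fun x => (gaussianPDFReal_std_pos x).le) (by simpa using H.integrable_density)
  simp only [zero_add, sub_zero, ← H.stableDensity_eq] at h
  rw [gaussianReal_of_var_ne_zero 0 one_ne_zero]
  exact h

theorem charFun_map_prod_mul (H : IsGaussianScaleMixture β ρ) (u : ℝ) :
    charFun ((ρ.prod (gaussianReal 0 1)).map (fun p => p.1 * p.2)) u =
      Complex.exp ((-(|u| ^ β / 2) : ℝ) : ℂ) := by
  have := H.prob
  have hint : Integrable (fun p : ℝ × ℝ => Complex.exp (u * ((p.1 * p.2 : ℝ) : ℂ) * Complex.I))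
      (ρ.prod (gaussianReal 0 1)) := by
    refine Integrable.of_bound (by fun_prop) 1 (ae_of_all _ fun p => ?_)
    rw [← Complex.ofReal_mul, Complex.norm_exp_ofReal_mul_I]
  rw [charFun_apply_real, integral_map (by fun_prop) (by fun_prop), integral_prod _ hint]
  have e : ∀ r : ℝ, ∫ z, Complex.exp (u * ((r * z : ℝ) : ℂ) * Complex.I) ∂(gaussianReal 0 1) =
      ((Real.exp (-(r ^ 2 * u ^ 2 / 2)) : ℝ) : ℂ) := by
    intro r
    have h := charFun_gaussianReal (μ := 0) (v := 1) (u * r)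
    rw [charFun_apply_real] at h
    push_cast at h ⊢
    simp only [mul_assoc] at h ⊢
    rw [h]
    congr 1
    ring
  simp_rw [e]
  rw [integral_complex_ofReal, H.charFun_eq, Complex.ofReal_exp]

theorem isProbabilityMeasure (H : IsGaussianScaleMixture β ρ) :
    IsProbabilityMeasure (volume.withDensity fun x => ENNReal.ofReal (stableDensity β x)) := by
  have := H.prob
  rw [← H.map_mul_eq]
  exact Measure.isProbabilityMeasure_map (by fun_prop)

theorem charFun_withDensity (H : IsGaussianScaleMixture β ρ) (u : ℝ) :
    charFun (volume.withDensity fun x => ENNReal.ofReal (stableDensity β x)) u =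
      Complex.exp ((-(|u| ^ β / 2) : ℝ) : ℂ) := by
  rw [← H.map_mul_eq, H.charFun_map_prod_mul]

/-- The tail of the stable density. By monotonicity, `h (z)` is at most the mean of `h` over
`(z / 2, z)`, and the tail of the law is controlled by its characteristic function at `0`. -/
theorem exists_stableDensity_le (H : IsGaussianScaleMixture β ρ) (hβ : 0 < β) :
    ∃ C, ∀ z : ℝ, z ≠ 0 → stableDensity β z ≤ C * |z| ^ (-(1 + β)) := by
  have := H.isProbabilityMeasure
  set μ := volume.withDensity fun x => ENNReal.ofReal (stableDensity β x) with hμ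
  have htail : ∀ r : ℝ, 0 < r → μ.real {x | r < |x|} ≤ 2 ^ β * r ^ (-β) := by
    intro r hr
    refine (measureReal_abs_gt_le_integral_charFun hr).trans ?_
    have hb : ∀ t ∈ Set.uIoc (-2 * r⁻¹) (2 * r⁻¹), ‖1 - charFun μ t‖ ≤ (2 * r⁻¹) ^ β / 2 := by
      intro t ht
      have hr' := inv_pos.2 hr
      rw [Set.uIoc_of_le (by linarith)] at ht
      have ht' : |t| ≤ 2 * r⁻¹ := abs_le.2 ⟨by linarith [ht.1], ht.2⟩
      have h1 : |t| ^ β ≤ (2 * r⁻¹) ^ β := Real.rpow_le_rpow (abs_nonneg t) ht' hβ.le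
      have h0 : 0 ≤ |t| ^ β := by positivity
      rw [hμ, H.charFun_withDensity, ← Complex.ofReal_exp, ← Complex.ofReal_one,
        ← Complex.ofReal_sub, Complex.norm_real, Real.norm_of_nonneg]
      · linarith [Real.add_one_le_exp (-(|t| ^ β / 2))]
      · rw [sub_nonneg, Real.exp_le_one_iff]
        linarith
    have h2 := intervalIntegral.norm_integral_le_of_norm_le_const hb
    have h3 : |2 * r⁻¹ - -2 * r⁻¹| = 4 * r⁻¹ := by
      rw [abs_of_pos (by have := inv_pos.2 hr; linarith)]
      ring
    rw [h3] at h2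
    calc 2⁻¹ * r * ‖∫ t in (-2 * r⁻¹)..(2 * r⁻¹), 1 - charFun μ t‖
        ≤ 2⁻¹ * r * ((2 * r⁻¹) ^ β / 2 * (4 * r⁻¹)) := by gcongr
      _ = 2 ^ β * r ^ (-β) := by
        rw [Real.mul_rpow zero_le_two (inv_pos.2 hr).le, Real.inv_rpow hr.le, Real.rpow_neg hr.le]
        field_simp
        norm_num
  refine ⟨2 * 2 ^ β * 2 ^ β, fun z hz => ?_⟩
  have hz' : 0 < |z| := abs_pos.2 hz
  have h1 : ENNReal.ofReal (stableDensity β z * (|z| / 2)) ≤ μ {x | |z| / 2 < |x|} := by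
    calc ENNReal.ofReal (stableDensity β z * (|z| / 2))
        = ∫⁻ _ in Set.Ioc (|z| / 2) |z|, ENNReal.ofReal (stableDensity β z) := by
          rw [setLIntegral_const, Real.volume_Ioc,
            ← ENNReal.ofReal_mul (H.stableDensity_pos z).le]
          congr 2
          ring
      _ ≤ ∫⁻ x in Set.Ioc (|z| / 2) |z|, ENNReal.ofReal (stableDensity β x) := by
          refine setLIntegral_mono' measurableSet_Ioc fun x hx => ENNReal.ofReal_le_ofReal ?_
          refine H.stableDensity_le_of_abs_le ?_
          rw [abs_of_pos (lt_trans (by positivity) hx.1)]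
          exact hx.2
      _ = μ (Set.Ioc (|z| / 2) |z|) := (withDensity_apply _ measurableSet_Ioc).symm
      _ ≤ μ {x | |z| / 2 < |x|} := measure_mono fun x hx => lt_of_lt_of_le hx.1 (le_abs_self x)
  have h2 : stableDensity β z * (|z| / 2) ≤ 2 ^ β * (|z| / 2) ^ (-β) := by
    refine le_trans ?_ (htail (|z| / 2) (by positivity))
    rw [measureReal_def, ← ENNReal.ofReal_le_iff_le_toReal (measure_ne_top _ _)]
    exact h1
  rw [Real.div_rpow hz'.le zero_le_two, Real.rpow_neg zero_le_two] at h2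
  have h3 : |z| ^ (-(1 + β)) = |z| ^ (-β) / |z| := by
    rw [← Real.rpow_sub_one hz'.ne']
    ring_nf
  rw [h3]
  have h4 : stableDensity β z ≤ 2 ^ β * (|z| ^ (-β) / (2 ^ β)⁻¹) / (|z| / 2) := by
    rwa [le_div_iff₀ (by positivity)]
  refine h4.trans (le_of_eq ?_)
  field_simp

/-- The component of standard deviation `r` has translation information `r ^ (-2)`, which is
integrable. -/
theorem lintegral_translationIntegrand_lt_top (H : IsGaussianScaleMixture β ρ) :
    ∫⁻ x, ENNReal.ofReal (translationIntegrand β x) < ⊤ := by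
  have := H.prob
  have h := lintegral_ofReal_sq_integral_div_le (κ := ρ)
    (f := fun r x => r⁻¹ * (r⁻¹ * (-(x / r) * gaussianPDFReal 0 1 (x / r))))
    (g := fun r x => r⁻¹ * gaussianPDFReal 0 1 (x / r)) (by fun_prop) (by fun_prop)
    (fun x => (H.hasDerivAt_stableDensity x).1) H.integrable_density (by
      filter_upwards [H.pos] with r hr x
      exact mul_pos (inv_pos.2 hr) (gaussianPDFReal_std_pos _))
  simp only [← H.stableDensity_eq, ← H.deriv_eq] at h
  refine lt_of_le_of_lt h ?_
  have e : ∀ᵐ r ∂ρ, ∫⁻ x, ENNReal.ofReal ((r⁻¹ * (r⁻¹ * (-(x / r) *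
      gaussianPDFReal 0 1 (x / r)))) ^ 2 / (r⁻¹ * gaussianPDFReal 0 1 (x / r))) =
      ENNReal.ofReal ((r ^ 2)⁻¹) * ∫⁻ x, ENNReal.ofReal
        ((-x * gaussianPDFReal 0 1 x) ^ 2 / gaussianPDFReal 0 1 x) := by
    filter_upwards [H.pos] with r hr
    have := lintegral_ofReal_sq_div_locationScale
      (A := fun x => -x * gaussianPDFReal 0 1 x) (q := gaussianPDFReal 0 1) (by fun_prop)
      (by fun_prop) r⁻¹ 0 hr
    simpa only [sub_zero, inv_pow] using this
  rw [lintegral_congr_ae e, lintegral_mul_const _ (by fun_prop)]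
  exact ENNReal.mul_lt_top H.integrable_inv_sq.lintegral_lt_top
    lintegral_gaussian_translation_lt_top

/-- All Gaussian components have the same scale information. -/
theorem lintegral_scaleIntegrand_lt_top (H : IsGaussianScaleMixture β ρ) :
    ∫⁻ x, ENNReal.ofReal (scaleIntegrand β x) < ⊤ := by
  have := H.prob
  have h := lintegral_ofReal_sq_integral_div_le (κ := ρ)
    (f := fun r x => r⁻¹ * (gaussianPDFReal 0 1 (x / r) +
      x / r * (-(x / r) * gaussianPDFReal 0 1 (x / r))))
    (g := fun r x => r⁻¹ * gaussianPDFReal 0 1 (x / r)) (by fun_prop) (by fun_prop)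
    (fun x => (H.stableDensity_add_mul_deriv_eq x).1) H.integrable_density (by
      filter_upwards [H.pos] with r hr x
      exact mul_pos (inv_pos.2 hr) (gaussianPDFReal_std_pos _))
  simp only [← H.stableDensity_eq, ← (H.stableDensity_add_mul_deriv_eq _).2] at h
  refine lt_of_le_of_lt h ?_
  have e : ∀ᵐ r ∂ρ, ∫⁻ x, ENNReal.ofReal ((r⁻¹ * (gaussianPDFReal 0 1 (x / r) +
      x / r * (-(x / r) * gaussianPDFReal 0 1 (x / r)))) ^ 2 /
        (r⁻¹ * gaussianPDFReal 0 1 (x / r))) =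
      ∫⁻ x, ENNReal.ofReal ((gaussianPDFReal 0 1 x + x * (-x * gaussianPDFReal 0 1 x)) ^ 2 /
        gaussianPDFReal 0 1 x) := by
    filter_upwards [H.pos] with r hr
    have := lintegral_ofReal_sq_div_locationScale
      (A := fun x => gaussianPDFReal 0 1 x + x * (-x * gaussianPDFReal 0 1 x))
      (q := gaussianPDFReal 0 1) (by fun_prop) (by fun_prop) 1 0 hr
    simpa only [sub_zero, one_mul, one_pow, ENNReal.ofReal_one] using this
  rw [lintegral_congr_ae e, lintegral_const, measure_univ, mul_one]
  exact lintegral_gaussian_scale_lt_top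

theorem translationIntegrand_nonneg (H : IsGaussianScaleMixture β ρ) (x : ℝ) :
    0 ≤ translationIntegrand β x :=
  div_nonneg (sq_nonneg _) (H.stableDensity_pos x).le

theorem scaleIntegrand_nonneg (H : IsGaussianScaleMixture β ρ) (x : ℝ) :
    0 ≤ scaleIntegrand β x :=
  div_nonneg (sq_nonneg _) (H.stableDensity_pos x).le

theorem integrable_translationIntegrand (H : IsGaussianScaleMixture β ρ) :
    Integrable (translationIntegrand β) := by
  refine ⟨?_, ?_⟩
  · have := H.continuous_stableDensity.measurable
    exact (((measurable_deriv _).pow_const 2).div this).aestronglyMeasurable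
  · rw [hasFiniteIntegral_iff_ofReal (ae_of_all _ H.translationIntegrand_nonneg)]
    exact H.lintegral_translationIntegrand_lt_top

theorem integrable_scaleIntegrand (H : IsGaussianScaleMixture β ρ) :
    Integrable (scaleIntegrand β) := by
  refine ⟨?_, ?_⟩
  · have := H.continuous_stableDensity.measurable
    exact (((this.add (measurable_id.mul (measurable_deriv _))).pow_const 2).div
      this).aestronglyMeasurable
  · rw [hasFiniteIntegral_iff_ofReal (ae_of_all _ H.scaleIntegrand_nonneg)]
    exact H.lintegral_scaleIntegrand_lt_top

/-- The law of the stable process at time `t`, from the self-similarity of its characteristic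
functions. -/
theorem map_stable_eq (H : IsGaussianScaleMixture β ρ) (hβ : 0 < β) {Ω : Type*}
    [MeasurableSpace Ω] {P : Measure Ω} [IsProbabilityMeasure P] {W : ℝ≥0 → Ω → ℝ}
    (hW : IsStandardSymmetricStable β W P) (t : ℝ≥0) :
    P.map (W t) = (volume.withDensity fun x => ENNReal.ofReal (stableDensity β x)).map
      (fun x => (t : ℝ) ^ (1 / β) * x) := by
  have := H.isProbabilityMeasure
  have h1 : IsProbabilityMeasure (P.map (W t)) :=
    Measure.isProbabilityMeasure_map (hW.levy.aemeasurable t)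
  have h2 : IsProbabilityMeasure ((volume.withDensity fun x =>
      ENNReal.ofReal (stableDensity β x)).map (fun x => (t : ℝ) ^ (1 / β) * x)) :=
    Measure.isProbabilityMeasure_map (by fun_prop)
  refine Measure.ext_of_charFun (funext fun u => ?_)
  rw [hW.charFun_eq, charFun_map_mul, H.charFun_withDensity, abs_mul,
    Real.mul_rpow (abs_nonneg _) (abs_nonneg _),
    abs_of_nonneg (Real.rpow_nonneg t.coe_nonneg (1 / β)),
    ← Real.rpow_mul t.coe_nonneg]
  have : 1 / β * β = 1 := by field_simp
  rw [this, Real.rpow_one]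

end IsGaussianScaleMixture

/-! ### The rescaled observation: informations and their limits -/

theorem poissonWeight_succ_mul (t : ℝ≥0) (n : ℕ) :
    Real.exp (-t) * (t : ℝ) ^ (n + 1) / (n + 1).factorial * (n + 1) =
      t * (Real.exp (-t) * (t : ℝ) ^ n / n.factorial) := by
  rw [Nat.factorial_succ]
  push_cast
  field_simp
  ring

theorem integrable_natCast_mul_poissonMeasure {t : ℝ≥0} {b : ℕ → ℝ}
    (hb : Integrable (fun k => b (k + 1)) (poissonMeasure t)) :
    Integrable (fun k : ℕ => (k : ℝ) * b k) (poissonMeasure t) := by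
  rw [integrable_poissonMeasure_iff] at hb ⊢
  rw [← summable_nat_add_iff 1]
  refine (hb.mul_left (t : ℝ)).congr fun n => ?_
  have h := poissonWeight_succ_mul t n
  rw [norm_mul, Real.norm_of_nonneg (Nat.cast_nonneg _)]
  push_cast
  rw [← mul_assoc, ← mul_assoc, h]

/-- Size biasing of the Poisson law. -/
theorem integral_natCast_mul_poissonMeasure {t : ℝ≥0} {b : ℕ → ℝ}
    (hb : Integrable (fun k => b (k + 1)) (poissonMeasure t)) :
    ∫ k : ℕ, (k : ℝ) * b k ∂(poissonMeasure t) = t * ∫ k, b (k + 1) ∂(poissonMeasure t) := by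
  have h1 := (hasSum_integral_poissonMeasure (integrable_natCast_mul_poissonMeasure hb)).summable
  rw [integral_poissonMeasure, integral_poissonMeasure, h1.tsum_eq_zero_add, ← tsum_mul_left]
  simp only [Nat.cast_zero, zero_mul, mul_zero, zero_add, smul_eq_mul]
  refine tsum_congr fun n => ?_
  have h := poissonWeight_succ_mul t n
  push_cast
  rw [← mul_assoc, ← mul_assoc, h]

theorem integrable_natCast_poissonMeasure (t : ℝ≥0) :
    Integrable (fun k : ℕ => (k : ℝ)) (poissonMeasure t) := by
  simpa using integrable_natCast_mul_poissonMeasure (t := t) (b := fun _ => 1)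
    (integrable_const _)

theorem integral_natCast_poissonMeasure (t : ℝ≥0) :
    ∫ k : ℕ, (k : ℝ) ∂(poissonMeasure t) = t := by
  simpa using integral_natCast_mul_poissonMeasure (t := t) (b := fun _ => 1)
    (integrable_const _)

theorem integrable_natCast_sq_poissonMeasure (t : ℝ≥0) :
    Integrable (fun k : ℕ => (k : ℝ) ^ 2) (poissonMeasure t) := by
  simpa [sq] using integrable_natCast_mul_poissonMeasure (t := t) (b := fun k => (k : ℝ))
    (by simpa using (integrable_natCast_poissonMeasure t).add (integrable_const 1))

theorem integral_natCast_sq_poissonMeasure (t : ℝ≥0) :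
    ∫ k : ℕ, (k : ℝ) ^ 2 ∂(poissonMeasure t) = t * (1 + t) := by
  have hi : Integrable (fun k : ℕ => ((k + 1 : ℕ) : ℝ)) (poissonMeasure t) := by
    simpa using (integrable_natCast_poissonMeasure t).add (integrable_const 1)
  have h := integral_natCast_mul_poissonMeasure (t := t) (b := fun k => (k : ℝ)) hi
  have h2 : ∫ k : ℕ, ((k + 1 : ℕ) : ℝ) ∂(poissonMeasure t) = 1 + t := by
    simp only [Nat.cast_add, Nat.cast_one]
    rw [integral_add (integrable_natCast_poissonMeasure t) (integrable_const 1),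
      integral_natCast_poissonMeasure]
    simp [add_comm]
  simp only [sq]
  rw [h, h2]

/-- As its parameter tends to `0`, the Poisson law concentrates at `0`. -/
theorem tendsto_integral_poissonMeasure {b : ℝ≥0 → ℕ → ℝ} {C v : ℝ} (hC : ∀ t k, |b t k| ≤ C)
    (h0 : ∀ t, b t 0 = v) :
    Tendsto (fun t => ∫ k, b t k ∂(poissonMeasure t)) (𝓝[>] 0) (𝓝 v) := by
  have hb : ∀ t, Integrable (b t) (poissonMeasure t) := fun t =>
    Integrable.of_bound Measurable.of_discrete.aestronglyMeasurable C
      (ae_of_all _ fun k => hC t k)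
  have hle : ∀ t : ℝ≥0, ‖(∫ k, b t k ∂(poissonMeasure t)) - v‖ ≤ 2 * C * t := by
    intro t
    have e : (∫ k, b t k ∂(poissonMeasure t)) - v = ∫ k, (b t k - v) ∂(poissonMeasure t) := by
      rw [integral_sub (hb t) (integrable_const v)]
      simp
    rw [e, ← integral_natCast_poissonMeasure t, ← integral_const_mul]
    refine norm_integral_le_of_norm_le ((integrable_natCast_poissonMeasure t).const_mul _)
      (ae_of_all _ fun k => ?_)
    rcases Nat.eq_zero_or_pos k with rfl | hk
    · simp [h0]
    · have h1 := hC t k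
      have h2 := hC t 0
      rw [h0] at h2
      have h3 : (1 : ℝ) ≤ k := by exact_mod_cast hk
      have h4 : 0 ≤ C := (abs_nonneg _).trans h2
      calc ‖b t k - v‖ ≤ |b t k| + |v| := abs_sub _ _
        _ ≤ 2 * C * 1 := by linarith
        _ ≤ 2 * C * k := by gcongr
  rw [tendsto_iff_norm_sub_tendsto_zero]
  refine squeeze_zero (fun _ => norm_nonneg _) hle ?_
  have : Tendsto (fun t : ℝ≥0 => 2 * C * (t : ℝ)) (𝓝 0) (𝓝 (2 * C * ((0 : ℝ≥0) : ℝ))) :=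
    (continuous_const.mul NNReal.continuous_coe).tendsto 0
  rw [NNReal.coe_zero, mul_zero] at this
  exact this.mono_left nhdsWithin_le_nhds

/-- The density of `W₁ + δ N` with `N` Poisson of parameter `t`. -/
noncomputable def shiftedDensity (β : ℝ) (t : ℝ≥0) (δ y : ℝ) : ℝ :=
  ∫ k : ℕ, stableDensity β (y - k * δ) ∂(poissonMeasure t)

/-- Minus the derivative in `s`, at `s = 1`, of the density of `s W₁ + δ N`. -/
noncomputable def shiftedScaleDeriv (β : ℝ) (t : ℝ≥0) (δ y : ℝ) : ℝ :=
  ∫ k : ℕ, (stableDensity β (y - k * δ) + (y - k * δ) * deriv (stableDensity β) (y - k * δ))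
    ∂(poissonMeasure t)

/-- Minus the derivative in `δ` of the density of `W₁ + δ N`. -/
noncomputable def shiftedJumpDeriv (β : ℝ) (t : ℝ≥0) (δ y : ℝ) : ℝ :=
  ∫ k : ℕ, (k : ℝ) * deriv (stableDensity β) (y - k * δ) ∂(poissonMeasure t)

theorem integrable_and_integral_le {f : ℝ → ℝ} {c : ℝ} (hm : AEStronglyMeasurable f volume)
    (hf : ∀ x, 0 ≤ f x) (hc : 0 ≤ c) (h : ∫⁻ x, ENNReal.ofReal (f x) ≤ ENNReal.ofReal c) :
    Integrable f ∧ ∫ x, f x ≤ c := by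
  refine ⟨⟨hm, ?_⟩, ?_⟩
  · rw [hasFiniteIntegral_iff_ofReal (ae_of_all _ hf)]
    exact h.trans_lt ENNReal.ofReal_lt_top
  · rw [integral_eq_lintegral_of_nonneg_ae (ae_of_all _ hf) hm]
    exact ENNReal.toReal_le_of_le_ofReal hc h

namespace IsGaussianScaleMixture

variable {β : ℝ} {ρ : Measure ℝ}

theorem stableDensity_le (H : IsGaussianScaleMixture β ρ) (x : ℝ) :
    |stableDensity β x| ≤ stableDensity β 0 := by
  rw [abs_of_pos (H.stableDensity_pos x)]
  exact H.stableDensity_le_of_abs_le (by simp)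

theorem measurable_stableDensity (H : IsGaussianScaleMixture β ρ) :
    Measurable (stableDensity β) := H.continuous_stableDensity.measurable

theorem integrable_shiftedDensity (H : IsGaussianScaleMixture β ρ) (t : ℝ≥0) (δ y : ℝ) :
    Integrable (fun k : ℕ => stableDensity β (y - k * δ)) (poissonMeasure t) :=
  Integrable.of_bound Measurable.of_discrete.aestronglyMeasurable _
    (ae_of_all _ fun _ => H.stableDensity_le _)

theorem integrable_shiftedScaleDeriv (H : IsGaussianScaleMixture β ρ) (t : ℝ≥0) (δ y : ℝ) :
    Integrable (fun k : ℕ => stableDensity β (y - k * δ) +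
      (y - k * δ) * deriv (stableDensity β) (y - k * δ)) (poissonMeasure t) :=
  Integrable.of_bound Measurable.of_discrete.aestronglyMeasurable _
    (ae_of_all _ fun _ => H.abs_stableDensity_add_mul_deriv_le _)

theorem integrable_deriv_shift (H : IsGaussianScaleMixture β ρ) (t : ℝ≥0) (δ y : ℝ) :
    Integrable (fun k : ℕ => deriv (stableDensity β) (y - k * δ)) (poissonMeasure t) :=
  Integrable.of_bound Measurable.of_discrete.aestronglyMeasurable _
    (ae_of_all _ fun _ => H.abs_deriv_le _)

theorem integrable_shiftedJumpDeriv (H : IsGaussianScaleMixture β ρ) (t : ℝ≥0) (δ y : ℝ) :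
    Integrable (fun k : ℕ => (k : ℝ) * deriv (stableDensity β) (y - k * δ))
      (poissonMeasure t) :=
  ((integrable_natCast_poissonMeasure t).mul_const _).mono'
    Measurable.of_discrete.aestronglyMeasurable (ae_of_all _ fun k => by
      rw [norm_mul, Real.norm_of_nonneg (Nat.cast_nonneg k)]
      exact mul_le_mul_of_nonneg_left (H.abs_deriv_le _) (Nat.cast_nonneg k))

theorem abs_shiftedJumpDeriv_le (H : IsGaussianScaleMixture β ρ) (t : ℝ≥0) (δ y : ℝ) :
    |shiftedJumpDeriv β t δ y| ≤ t * ∫ r, (r ^ 2)⁻¹ ∂ρ := by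
  rw [shiftedJumpDeriv, ← Real.norm_eq_abs, ← integral_natCast_poissonMeasure t,
    ← integral_mul_const]
  refine norm_integral_le_of_norm_le ((integrable_natCast_poissonMeasure t).mul_const _)
    (ae_of_all _ fun k => ?_)
  rw [norm_mul, Real.norm_of_nonneg (Nat.cast_nonneg k)]
  exact mul_le_mul_of_nonneg_left (H.abs_deriv_le _) (Nat.cast_nonneg k)

theorem shiftedDensity_pos (H : IsGaussianScaleMixture β ρ) (t : ℝ≥0) (δ y : ℝ) :
    0 < shiftedDensity β t δ y := by
  rw [shiftedDensity, integral_pos_iff_support_of_nonneg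
    (fun k => (H.stableDensity_pos _).le) (H.integrable_shiftedDensity t δ y)]
  have : (Function.support fun k : ℕ => stableDensity β (y - k * δ)) = Set.univ :=
    Set.eq_univ_of_forall fun k => (H.stableDensity_pos _).ne'
  rw [this, measure_univ]
  exact one_pos

theorem measurable_shift (H : IsGaussianScaleMixture β ρ) (δ : ℝ) :
    Measurable (Function.uncurry fun (k : ℕ) (y : ℝ) => stableDensity β (y - k * δ)) ∧
    Measurable (Function.uncurry fun (k : ℕ) (y : ℝ) => stableDensity β (y - k * δ) +
      (y - k * δ) * deriv (stableDensity β) (y - k * δ)) ∧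
    Measurable (Function.uncurry fun (k : ℕ) (y : ℝ) =>
      (k : ℝ) * deriv (stableDensity β) (y - k * δ)) := by
  have h1 := H.measurable_stableDensity
  have h2 := measurable_deriv (stableDensity β)
  have h3 : Measurable fun p : ℕ × ℝ => (p.1 : ℝ) := Measurable.of_discrete.comp measurable_fst
  have h4 : Measurable fun p : ℕ × ℝ => p.2 - p.1 * δ := measurable_snd.sub (h3.mul_const δ)
  exact ⟨h1.comp h4, (h1.comp h4).add (h4.mul (h2.comp h4)), h3.mul (h2.comp h4)⟩

theorem measurable_shiftedDensity (H : IsGaussianScaleMixture β ρ) (t : ℝ≥0) (δ : ℝ) :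
    Measurable (shiftedDensity β t δ) :=
  ((H.measurable_shift δ).1.stronglyMeasurable.integral_prod_left
    (μ := poissonMeasure t)).measurable

theorem measurable_shiftedScaleDeriv (H : IsGaussianScaleMixture β ρ) (t : ℝ≥0) (δ : ℝ) :
    Measurable (shiftedScaleDeriv β t δ) :=
  ((H.measurable_shift δ).2.1.stronglyMeasurable.integral_prod_left
    (μ := poissonMeasure t)).measurable

theorem measurable_shiftedJumpDeriv (H : IsGaussianScaleMixture β ρ) (t : ℝ≥0) (δ : ℝ) :
    Measurable (shiftedJumpDeriv β t δ) :=
  ((H.measurable_shift δ).2.2.stronglyMeasurable.integral_prod_left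
    (μ := poissonMeasure t)).measurable

/-- Adding an independent variable to `s W₁` does not increase the information on `s`. -/
theorem integral_scale_le (H : IsGaussianScaleMixture β ρ) (t : ℝ≥0) (δ : ℝ) :
    Integrable (fun y => shiftedScaleDeriv β t δ y ^ 2 / shiftedDensity β t δ y) ∧
    ∫ y, shiftedScaleDeriv β t δ y ^ 2 / shiftedDensity β t δ y ≤ scaleInfo β := by
  refine integrable_and_integral_le ?_
    (fun y => div_nonneg (sq_nonneg _) (H.shiftedDensity_pos t δ y).le)
    (integral_nonneg H.scaleIntegrand_nonneg) ?_
  · exact (((H.measurable_shiftedScaleDeriv t δ).pow_const 2).div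
      (H.measurable_shiftedDensity t δ)).aestronglyMeasurable
  · refine (lintegral_ofReal_sq_integral_div_le (κ := poissonMeasure t) (H.measurable_shift δ).2.1
      (H.measurable_shift δ).1 (H.integrable_shiftedScaleDeriv t δ)
      (H.integrable_shiftedDensity t δ)
      (ae_of_all _ fun k x => H.stableDensity_pos _)).trans (le_of_eq ?_)
    have e : ∀ k : ℕ, ∫⁻ x, ENNReal.ofReal ((stableDensity β (x - k * δ) +
        (x - k * δ) * deriv (stableDensity β) (x - k * δ)) ^ 2 / stableDensity β (x - k * δ)) =
        ENNReal.ofReal (scaleInfo β) := by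
      intro k
      rw [scaleInfo, ofReal_integral_eq_lintegral_ofReal H.integrable_scaleIntegrand
        (ae_of_all _ H.scaleIntegrand_nonneg)]
      exact lintegral_sub_right_eq_self (fun x => ENNReal.ofReal (scaleIntegrand β x)) (k * δ)
    simp_rw [e]
    simp

/-- The translation information, weighted by the mean square of the number of jumps. -/
theorem integral_jump_le (H : IsGaussianScaleMixture β ρ) (t : ℝ≥0) (δ : ℝ) :
    Integrable (fun y => shiftedJumpDeriv β t δ y ^ 2 / shiftedDensity β t δ y) ∧
    ∫ y, shiftedJumpDeriv β t δ y ^ 2 / shiftedDensity β t δ y ≤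
      t * (1 + t) * translationInfo β := by
  have hJ : 0 ≤ translationInfo β := integral_nonneg H.translationIntegrand_nonneg
  refine integrable_and_integral_le ?_
    (fun y => div_nonneg (sq_nonneg _) (H.shiftedDensity_pos t δ y).le)
    (by positivity) ?_
  · exact (((H.measurable_shiftedJumpDeriv t δ).pow_const 2).div
      (H.measurable_shiftedDensity t δ)).aestronglyMeasurable
  · refine (lintegral_ofReal_sq_integral_div_le (κ := poissonMeasure t) (H.measurable_shift δ).2.2
      (H.measurable_shift δ).1 (H.integrable_shiftedJumpDeriv t δ)
      (H.integrable_shiftedDensity t δ)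
      (ae_of_all _ fun k x => H.stableDensity_pos _)).trans (le_of_eq ?_)
    have e : ∀ k : ℕ, ∫⁻ x, ENNReal.ofReal (((k : ℝ) * deriv (stableDensity β) (x - k * δ)) ^ 2 /
        stableDensity β (x - k * δ)) =
        ENNReal.ofReal ((k : ℝ) ^ 2 * translationInfo β) := by
      intro k
      rw [translationInfo, ENNReal.ofReal_mul (sq_nonneg _),
        ofReal_integral_eq_lintegral_ofReal H.integrable_translationIntegrand
        (ae_of_all _ H.translationIntegrand_nonneg), ← lintegral_const_mul' _ _ (by simp),
        ← lintegral_sub_right_eq_self (fun x => ENNReal.ofReal ((k : ℝ) ^ 2) *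
          ENNReal.ofReal (translationIntegrand β x)) (k * δ)]
      refine lintegral_congr fun x => ?_
      rw [← ENNReal.ofReal_mul (sq_nonneg _), translationIntegrand, mul_pow, mul_div_assoc]
    simp_rw [e]
    rw [← ofReal_integral_eq_lintegral_ofReal
      ((integrable_natCast_sq_poissonMeasure t).mul_const _)
      (ae_of_all _ fun k => by positivity), integral_mul_const,
      integral_natCast_sq_poissonMeasure]

theorem integrable_mixed (H : IsGaussianScaleMixture β ρ) (t : ℝ≥0) (δ : ℝ) :
    Integrable fun y => shiftedScaleDeriv β t δ y * shiftedJumpDeriv β t δ y /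
      shiftedDensity β t δ y := by
  refine ((H.integral_scale_le t δ).1.add (H.integral_jump_le t δ).1).mono' ?_
    (ae_of_all _ fun y => ?_)
  · exact (((H.measurable_shiftedScaleDeriv t δ).mul (H.measurable_shiftedJumpDeriv t δ)).div
      (H.measurable_shiftedDensity t δ)).aestronglyMeasurable
  · have hp := H.shiftedDensity_pos t δ y
    rw [norm_div, Real.norm_of_nonneg hp.le, Pi.add_apply, ← add_div, Real.norm_eq_abs]
    refine div_le_div_of_nonneg_right (abs_le.2 ⟨?_, ?_⟩) hp.le
    · nlinarith [sq_nonneg (shiftedScaleDeriv β t δ y + shiftedJumpDeriv β t δ y),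
        sq_nonneg (shiftedScaleDeriv β t δ y), sq_nonneg (shiftedJumpDeriv β t δ y)]
    · nlinarith [sq_nonneg (shiftedScaleDeriv β t δ y - shiftedJumpDeriv β t δ y),
        sq_nonneg (shiftedScaleDeriv β t δ y), sq_nonneg (shiftedJumpDeriv β t δ y)]

theorem tendsto_shiftedDensity (H : IsGaussianScaleMixture β ρ) (δ : ℝ≥0 → ℝ) (y : ℝ) :
    Tendsto (fun t => shiftedDensity β t (δ t) y) (𝓝[>] 0) (𝓝 (stableDensity β y)) :=
  tendsto_integral_poissonMeasure (b := fun t k => stableDensity β (y - k * δ t))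
    (fun _ _ => H.stableDensity_le _) (by simp)

theorem tendsto_shiftedScaleDeriv (H : IsGaussianScaleMixture β ρ) (δ : ℝ≥0 → ℝ) (y : ℝ) :
    Tendsto (fun t => shiftedScaleDeriv β t (δ t) y) (𝓝[>] 0)
      (𝓝 (stableDensity β y + y * deriv (stableDensity β) y)) :=
  tendsto_integral_poissonMeasure (b := fun t k => stableDensity β (y - k * δ t) +
      (y - k * δ t) * deriv (stableDensity β) (y - k * δ t))
    (fun _ _ => H.abs_stableDensity_add_mul_deriv_le _) (by simp)

/-- The scale information converges. -/
theorem tendsto_integral_scale (H : IsGaussianScaleMixture β ρ) (δ : ℝ≥0 → ℝ) :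
    Tendsto (fun t => ∫ y, shiftedScaleDeriv β t (δ t) y ^ 2 / shiftedDensity β t (δ t) y)
      (𝓝[>] 0) (𝓝 (scaleInfo β)) :=
  tendsto_integral_of_integral_le (b := fun _ => scaleInfo β)
    (Eventually.of_forall fun t => (H.integral_scale_le t (δ t)).1)
    (Eventually.of_forall fun _ y => div_nonneg (sq_nonneg _) (H.shiftedDensity_pos _ _ y).le)
    H.integrable_scaleIntegrand
    (fun y => ((H.tendsto_shiftedScaleDeriv δ y).pow 2).div (H.tendsto_shiftedDensity δ y)
      (H.stableDensity_pos y).ne')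
    (Eventually.of_forall fun t => (H.integral_scale_le t (δ t)).2) tendsto_const_nhds

/-- Around the location of the first jump the derivative in the jump size is, relatively to the
parameter of the Poisson law, that of the translation model. -/
theorem tendsto_inv_mul_shiftedJumpDeriv (H : IsGaussianScaleMixture β ρ) (δ : ℝ≥0 → ℝ) (y : ℝ) :
    Tendsto (fun t : ℝ≥0 => (t : ℝ)⁻¹ * shiftedJumpDeriv β t (δ t) (y + δ t)) (𝓝[>] 0)
      (𝓝 (deriv (stableDensity β) y)) := by
  refine (tendsto_integral_poissonMeasure (b := fun t k => deriv (stableDensity β) (y - k * δ t))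
    (fun _ _ => H.abs_deriv_le _) (by simp)).congr' ?_
  filter_upwards [self_mem_nhdsWithin] with t ht
  have ht' : (0 : ℝ) < t := ht
  have e : ∀ k : ℕ, y + δ t - ((k + 1 : ℕ) : ℝ) * δ t = y - k * δ t := by
    intro k
    push_cast
    ring
  rw [shiftedJumpDeriv, integral_natCast_mul_poissonMeasure
    (b := fun k => deriv (stableDensity β) (y + δ t - k * δ t))
    (by simpa only [e] using H.integrable_deriv_shift t (δ t) y)]
  simp only [e]
  rw [← mul_assoc, inv_mul_cancel₀ ht'.ne', one_mul]

/-- Around the location of the first jump, the contribution of the event of no jump to the density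
is negligible, by the tail of the stable density. -/
theorem tendsto_inv_mul_shiftedDensity (H : IsGaussianScaleMixture β ρ) (hβ : 0 < β) {c : ℝ}
    (hc : c ≠ 0) (y : ℝ) :
    Tendsto (fun t : ℝ≥0 => (t : ℝ)⁻¹ *
      shiftedDensity β t (c / (t : ℝ) ^ (1 / β)) (y + c / (t : ℝ) ^ (1 / β))) (𝓝[>] 0)
      (𝓝 (stableDensity β y)) := by
  set δ : ℝ≥0 → ℝ := fun t => c / (t : ℝ) ^ (1 / β) with hδ
  change Tendsto (fun t : ℝ≥0 => (t : ℝ)⁻¹ * shiftedDensity β t (δ t) (y + δ t)) _ _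
  have hcoe : Tendsto (fun t : ℝ≥0 => (t : ℝ)) (𝓝[>] 0) (𝓝 0) :=
    (NNReal.continuous_coe.tendsto 0).mono_left nhdsWithin_le_nhds
  have hpow : Tendsto (fun t : ℝ≥0 => (t : ℝ) ^ (1 / β)) (𝓝[>] 0) (𝓝 0) := by
    have := hcoe.rpow_const (p := 1 / β) (Or.inr (by positivity))
    rwa [Real.zero_rpow (by positivity)] at this
  have h1 : Tendsto (fun t => ∫ k : ℕ, ((k : ℝ) + 1)⁻¹ * stableDensity β (y - k * δ t)
      ∂(poissonMeasure t)) (𝓝[>] 0) (𝓝 (stableDensity β y)) := by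
    refine tendsto_integral_poissonMeasure (C := stableDensity β 0)
      (b := fun t k => ((k : ℝ) + 1)⁻¹ * stableDensity β (y - k * δ t)) (fun t k => ?_) (by simp)
    rw [abs_mul, abs_of_pos (by positivity)]
    refine (mul_le_of_le_one_left (abs_nonneg _) (inv_le_one_of_one_le₀ ?_)).trans
      (H.stableDensity_le _)
    linarith [k.cast_nonneg (α := ℝ)]
  have h2 : Tendsto (fun t : ℝ≥0 => (t : ℝ)⁻¹ * (Real.exp (-t) * stableDensity β (y + δ t)))
      (𝓝[>] 0) (𝓝 0) := by
    obtain ⟨C, hC⟩ := H.exists_stableDensity_le hβ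
    have hC0 : 0 ≤ C := by
      have := (H.stableDensity_pos 1).le.trans (hC 1 one_ne_zero)
      simpa using this
    have hlim : Tendsto (fun t : ℝ≥0 => C * (|c| / 2) ^ (-(1 + β)) * (t : ℝ) ^ (1 / β))
        (𝓝[>] 0) (𝓝 0) := by
      simpa using hpow.const_mul (C * (|c| / 2) ^ (-(1 + β)))
    have hc' : 0 < |c| := abs_pos.2 hc
    have hsmall : ∀ᶠ t : ℝ≥0 in 𝓝[>] 0, |y| * (t : ℝ) ^ (1 / β) < |c| / 2 := by
      have := hpow.const_mul |y|
      rw [mul_zero] at this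
      exact this.eventually (gt_mem_nhds (by positivity))
    refine tendsto_of_tendsto_of_tendsto_of_le_of_le' tendsto_const_nhds hlim ?_ ?_
    · refine Eventually.of_forall fun t => ?_
      have := (H.stableDensity_pos (y + δ t)).le
      positivity
    · filter_upwards [hsmall, self_mem_nhdsWithin] with t hs ht
      have ht' : (0 : ℝ) < t := ht
      have hd : 0 < (t : ℝ) ^ (1 / β) := by positivity
      -- the distance to the position without jump is at least half of the scaled jump
      have hz : |c| / 2 / (t : ℝ) ^ (1 / β) ≤ |y + δ t| := by
        have h3 : |δ t| = |c| / (t : ℝ) ^ (1 / β) := by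
          rw [hδ]
          simp only [abs_div, abs_of_pos hd]
        have h4 : |y| ≤ |c| / 2 / (t : ℝ) ^ (1 / β) := by
          rw [le_div_iff₀ hd]
          exact hs.le
        have h5 : |δ t| ≤ |y + δ t| + |y| := by
          have := abs_sub (y + δ t) y
          simpa using this
        have h6 : |c| / (t : ℝ) ^ (1 / β) = |c| / 2 / (t : ℝ) ^ (1 / β) +
            |c| / 2 / (t : ℝ) ^ (1 / β) := by ring
        linarith
      have hz0 : 0 < |c| / 2 / (t : ℝ) ^ (1 / β) := by positivity
      have hzne : y + δ t ≠ 0 := abs_pos.1 (hz0.trans_le hz)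
      have h7 : |y + δ t| ^ (-(1 + β)) ≤ (|c| / 2 / (t : ℝ) ^ (1 / β)) ^ (-(1 + β)) :=
        Real.rpow_le_rpow_of_nonpos hz0 hz (by linarith)
      have h8 : (|c| / 2 / (t : ℝ) ^ (1 / β)) ^ (-(1 + β)) =
          (|c| / 2) ^ (-(1 + β)) * ((t : ℝ) ^ (1 / β) * t) := by
        rw [Real.div_rpow (by positivity) hd.le, ← Real.rpow_mul ht'.le, div_eq_mul_inv,
          ← Real.rpow_neg ht'.le, ← Real.rpow_add_one ht'.ne']
        congr 2
        field_simp
      have h9 : Real.exp (-(t : ℝ)) ≤ 1 := by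
        rw [Real.exp_le_one_iff]
        linarith
      calc (t : ℝ)⁻¹ * (Real.exp (-t) * stableDensity β (y + δ t))
          ≤ (t : ℝ)⁻¹ * (1 * (C * ((|c| / 2) ^ (-(1 + β)) * ((t : ℝ) ^ (1 / β) * t)))) := by
            rw [← h8]
            gcongr
            · exact (H.stableDensity_pos _).le
            · exact (hC _ hzne).trans (by gcongr)
        _ = C * (|c| / 2) ^ (-(1 + β)) * (t : ℝ) ^ (1 / β) := by field_simp
  have h12 := h2.add h1
  rw [zero_add] at h12
  refine h12.congr' ?_
  filter_upwards [self_mem_nhdsWithin] with t ht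
  have ht' : (0 : ℝ) < t := ht
  -- split off the event of no jump and apply size biasing to the rest
  set b : ℕ → ℝ := fun k => (k : ℝ)⁻¹ * stableDensity β (y + δ t - k * δ t) with hb
  have e : ∀ k : ℕ, b (k + 1) = ((k : ℝ) + 1)⁻¹ * stableDensity β (y - k * δ t) := by
    intro k
    simp only [hb]
    push_cast
    congr 2
    ring
  have hbi : Integrable (fun k => b (k + 1)) (poissonMeasure t) := by
    refine Integrable.of_bound Measurable.of_discrete.aestronglyMeasurable (stableDensity β 0)
      (ae_of_all _ fun k => ?_)
    rw [e, Real.norm_eq_abs, abs_mul, abs_of_pos (by positivity)]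
    refine (mul_le_of_le_one_left (abs_nonneg _) (inv_le_one_of_one_le₀ ?_)).trans
      (H.stableDensity_le _)
    linarith [k.cast_nonneg (α := ℝ)]
  have hsplit : ∀ k : ℕ, stableDensity β (y + δ t - k * δ t) =
      Set.indicator {0} (fun _ => stableDensity β (y + δ t)) k + (k : ℝ) * b k := by
    intro k
    rcases Nat.eq_zero_or_pos k with rfl | hk
    · simp
    · have hk' : (k : ℝ) ≠ 0 := by positivity
      rw [Set.indicator_of_notMem (by simpa using hk.ne'), zero_add, hb]
      simp only
      rw [mul_inv_cancel_left₀ hk']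
  rw [shiftedDensity]
  simp_rw [hsplit]
  rw [integral_add ((integrable_const _).indicator (MeasurableSet.singleton 0))
    (integrable_natCast_mul_poissonMeasure hbi), integral_natCast_mul_poissonMeasure hbi,
    integral_indicator_const _ (MeasurableSet.singleton 0), poissonMeasure_real_singleton, mul_add,
    ← mul_assoc _ (t : ℝ), inv_mul_cancel₀ ht'.ne', one_mul]
  simp [e]

/-- The information on the jump size, relatively to the parameter of the Poisson law, converges to
the translation information. -/
theorem tendsto_integral_jump (H : IsGaussianScaleMixture β ρ) (hβ : 0 < β) {c : ℝ} (hc : c ≠ 0) :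
    Tendsto (fun t : ℝ≥0 => (t : ℝ)⁻¹ * ∫ y, shiftedJumpDeriv β t (c / (t : ℝ) ^ (1 / β)) y ^ 2 /
        shiftedDensity β t (c / (t : ℝ) ^ (1 / β)) y)
      (𝓝[>] 0) (𝓝 (translationInfo β)) := by
  set δ : ℝ≥0 → ℝ := fun t => c / (t : ℝ) ^ (1 / β) with hδ
  have hev : ∀ᶠ t : ℝ≥0 in 𝓝[>] 0, (0 : ℝ) < t := by
    filter_upwards [self_mem_nhdsWithin] with t ht using ht
  have hform : ∀ᶠ t : ℝ≥0 in 𝓝[>] 0, ∀ y,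
      ((t : ℝ)⁻¹ * shiftedJumpDeriv β t (δ t) (y + δ t)) ^ 2 /
        ((t : ℝ)⁻¹ * shiftedDensity β t (δ t) (y + δ t)) =
      (t : ℝ)⁻¹ * (fun y => shiftedJumpDeriv β t (δ t) y ^ 2 / shiftedDensity β t (δ t) y)
        (y + δ t) := by
    filter_upwards [hev] with t ht y
    have := (H.shiftedDensity_pos t (δ t) (y + δ t)).ne'
    field_simp
  have hint : ∀ᶠ t : ℝ≥0 in 𝓝[>] 0, ∫ y,
      ((t : ℝ)⁻¹ * shiftedJumpDeriv β t (δ t) (y + δ t)) ^ 2 /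
        ((t : ℝ)⁻¹ * shiftedDensity β t (δ t) (y + δ t)) =
      (t : ℝ)⁻¹ * ∫ y, shiftedJumpDeriv β t (δ t) y ^ 2 / shiftedDensity β t (δ t) y := by
    filter_upwards [hform] with t ht
    rw [integral_congr_ae (ae_of_all _ ht), integral_const_mul,
      integral_add_right_eq_self (fun y => shiftedJumpDeriv β t (δ t) y ^ 2 /
        shiftedDensity β t (δ t) y)]
  have hcoe : Tendsto (fun t : ℝ≥0 => (t : ℝ)) (𝓝[>] 0) (𝓝 0) :=
    (NNReal.continuous_coe.tendsto 0).mono_left nhdsWithin_le_nhds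
  refine Tendsto.congr' hint (tendsto_integral_of_integral_le
    (b := fun t : ℝ≥0 => (1 + (t : ℝ)) * translationInfo β) ?_ ?_
    H.integrable_translationIntegrand
    (fun y => ((H.tendsto_inv_mul_shiftedJumpDeriv δ y).pow 2).div
      (H.tendsto_inv_mul_shiftedDensity hβ hc y) (H.stableDensity_pos y).ne') ?_ ?_)
  · filter_upwards [hform] with t ht
    simp_rw [ht]
    exact ((H.integral_jump_le t (δ t)).1.comp_add_right (δ t)).const_mul _
  · filter_upwards [hev] with t ht y
    have := (H.shiftedDensity_pos t (δ t) (y + δ t)).le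
    positivity
  · filter_upwards [hint, hev] with t h1 h2
    rw [h1, inv_mul_le_iff₀ h2, ← mul_assoc]
    exact (H.integral_jump_le t (δ t)).2
  · change Tendsto _ _ (𝓝 (translationInfo β))
    have := (hcoe.const_add 1).mul_const (translationInfo β)
    simpa using this

/-- The scale part of the score lives around the origin, the jump part does not: the mixed
information is negligible. -/
theorem tendsto_integral_mixed (H : IsGaussianScaleMixture β ρ) (δ : ℝ≥0 → ℝ) :
    Tendsto (fun t : ℝ≥0 => (t : ℝ) ^ (-(1 / 2) : ℝ) * ∫ y, shiftedScaleDeriv β t (δ t) y *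
        shiftedJumpDeriv β t (δ t) y / shiftedDensity β t (δ t) y)
      (𝓝[>] 0) (𝓝 0) := by
  set J := translationInfo β with hJ
  have hJ0 : 0 ≤ J := integral_nonneg H.translationIntegrand_nonneg
  set a : ℝ≥0 → ℝ → ℝ := fun t y => shiftedScaleDeriv β t (δ t) y with ha
  set p : ℝ≥0 → ℝ → ℝ := fun t y => shiftedDensity β t (δ t) y with hp
  set g : ℝ≥0 → ℝ → ℝ := fun t y => (t : ℝ) ^ (-(1 / 2) : ℝ) * shiftedJumpDeriv β t (δ t) y
    with hg
  have hp0 : ∀ t y, 0 < p t y := fun t y => H.shiftedDensity_pos _ _ _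
  have hev : ∀ᶠ t : ℝ≥0 in 𝓝[>] 0, (0 : ℝ) < t := by
    filter_upwards [self_mem_nhdsWithin] with t ht using ht
  have hcoe : Tendsto (fun t : ℝ≥0 => (t : ℝ)) (𝓝[>] 0) (𝓝 0) :=
    (NNReal.continuous_coe.tendsto 0).mono_left nhdsWithin_le_nhds
  have hsq : ∀ t : ℝ≥0, (0 : ℝ) < t → ((t : ℝ) ^ (-(1 / 2) : ℝ)) ^ 2 = (t : ℝ)⁻¹ := by
    intro t ht
    rw [← Real.rpow_natCast, ← Real.rpow_mul ht.le]
    norm_num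
    exact Real.rpow_neg_one _
  have hgi : ∀ t : ℝ≥0, (0 : ℝ) < t → Integrable (fun y => g t y ^ 2 / p t y) ∧
      ∫ y, g t y ^ 2 / p t y ≤ (1 + t) * J := by
    intro t ht
    have e : ∀ y, g t y ^ 2 / p t y =
        (t : ℝ)⁻¹ * (shiftedJumpDeriv β t (δ t) y ^ 2 / shiftedDensity β t (δ t) y) := by
      intro y
      rw [hg, mul_pow, hsq t ht, mul_div_assoc]
    simp_rw [e]
    refine ⟨(H.integral_jump_le t (δ t)).1.const_mul _, ?_⟩
    rw [integral_const_mul, inv_mul_le_iff₀ ht, ← mul_assoc]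
    exact (H.integral_jump_le t (δ t)).2
  have hagi : ∀ t : ℝ≥0, Integrable fun y => a t y * g t y / p t y := by
    intro t
    refine ((H.integrable_mixed t (δ t)).const_mul ((t : ℝ) ^ (-(1 / 2) : ℝ))).congr
      (ae_of_all _ fun y => ?_)
    simp only [ha, hg, hp]
    ring
  have hg0 : ∀ y, Tendsto (fun t => g t y) (𝓝[>] 0) (𝓝 0) := by
    intro y
    have hlim : Tendsto (fun t : ℝ≥0 => (t : ℝ) ^ (1 / 2 : ℝ) * ∫ r, (r ^ 2)⁻¹ ∂ρ) (𝓝[>] 0)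
        (𝓝 0) := by
      have := (hcoe.rpow_const (p := 1 / 2) (Or.inr (by norm_num))).mul_const
        (∫ r, (r ^ 2)⁻¹ ∂ρ)
      rwa [Real.zero_rpow (by norm_num), zero_mul] at this
    refine squeeze_zero_norm' ?_ hlim
    filter_upwards [hev] with t ht
    have e : (t : ℝ) ^ (-(1 / 2) : ℝ) * t = (t : ℝ) ^ (1 / 2 : ℝ) := by
      rw [← Real.rpow_add_one ht.ne']
      norm_num
    simp only [hg]
    rw [norm_mul, Real.norm_of_nonneg (by positivity), ← e, mul_assoc]
    exact mul_le_mul_of_nonneg_left (H.abs_shiftedJumpDeriv_le _ _ _) (by positivity)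
  have heq : ∀ t : ℝ≥0, (t : ℝ) ^ (-(1 / 2) : ℝ) * ∫ y, shiftedScaleDeriv β t (δ t) y *
        shiftedJumpDeriv β t (δ t) y / shiftedDensity β t (δ t) y =
      ∫ y, a t y * g t y / p t y := by
    intro t
    rw [← integral_const_mul]
    refine integral_congr_ae (ae_of_all _ fun y => ?_)
    simp only [ha, hg, hp]
    ring
  simp_rw [heq]
  -- the part of `|a g| / p` above `ε g ^ 2 / p` is at most `a ^ 2 / (4 ε p)`
  have hrem : ∀ ε : ℝ, 0 < ε → Tendsto (fun t => ∫ y,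
      max (|a t y * g t y / p t y| - ε * (g t y ^ 2 / p t y)) 0) (𝓝[>] 0) (𝓝 0) := by
    intro ε hε
    refine tendsto_integral_zero_of_le
      (f := fun t y => (4 * ε)⁻¹ * (a t y ^ 2 / p t y))
      (F := fun y => (4 * ε)⁻¹ * scaleIntegrand β y) ?_ ?_ ?_ ?_
      (H.integrable_scaleIntegrand.const_mul _) (fun y => ?_) (fun y => ?_) ?_
    · exact Eventually.of_forall fun t => (H.integral_scale_le t (δ t)).1.const_mul _
    · filter_upwards [hev] with t ht
      exact ((hagi t).abs.sub ((hgi t ht).1.const_mul ε)).pos_part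
    · exact Eventually.of_forall fun t y => le_max_right _ _
    · refine Eventually.of_forall fun t y => max_le ?_ ?_
      · have h0 := hp0 t y
        rw [abs_div, abs_of_pos h0, ← mul_div_assoc, ← mul_div_assoc, ← sub_div]
        refine div_le_div_of_nonneg_right ?_ h0.le
        rw [le_inv_mul_iff₀ (by positivity), abs_mul, ← sq_abs (a t y),
          ← sq_abs (g t y)]
        linarith [sq_nonneg (|a t y| - 2 * ε * |g t y|)]
      · have h0 := hp0 t y
        positivity
    · exact (((H.tendsto_shiftedScaleDeriv δ y).pow 2).div (H.tendsto_shiftedDensity δ y)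
        (H.stableDensity_pos y).ne').const_mul _
    · have h1 := (((H.tendsto_shiftedScaleDeriv δ y).mul (hg0 y)).div
        (H.tendsto_shiftedDensity δ y) (H.stableDensity_pos y).ne').abs
      have h2 := (((hg0 y).pow 2).div (H.tendsto_shiftedDensity δ y)
        (H.stableDensity_pos y).ne').const_mul ε
      have h3 := (h1.sub h2).max (tendsto_const_nhds (x := (0 : ℝ)))
      simpa using h3
    · simp_rw [integral_const_mul]
      exact (H.tendsto_integral_scale δ).const_mul _
  rw [Metric.tendsto_nhds]
  intro η hη
  set ε := η / (4 * (J + 1)) with hε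
  have hε0 : 0 < ε := by positivity
  have h1 : ∀ᶠ t in 𝓝[>] 0, ∫ y,
      max (|a t y * g t y / p t y| - ε * (g t y ^ 2 / p t y)) 0 < η / 2 :=
    (hrem ε hε0).eventually (gt_mem_nhds (by positivity))
  have h2 : ∀ᶠ t : ℝ≥0 in 𝓝[>] 0, (t : ℝ) < 1 := hcoe.eventually (gt_mem_nhds one_pos)
  filter_upwards [h1, h2, hev] with t ht1 ht2 ht
  rw [dist_zero_right]
  have hI := hgi t ht
  have hmax : Integrable fun y => max (|a t y * g t y / p t y| - ε * (g t y ^ 2 / p t y)) 0 :=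
    ((hagi t).abs.sub (hI.1.const_mul ε)).pos_part
  calc ‖∫ y, a t y * g t y / p t y‖
      ≤ ∫ y, (max (|a t y * g t y / p t y| - ε * (g t y ^ 2 / p t y)) 0 +
          ε * (g t y ^ 2 / p t y)) := by
        refine norm_integral_le_of_norm_le (hmax.add (hI.1.const_mul ε)) (ae_of_all _ fun y => ?_)
        have := le_max_left (|a t y * g t y / p t y| - ε * (g t y ^ 2 / p t y)) 0
        rw [Real.norm_eq_abs]
        linarith
    _ = (∫ y, max (|a t y * g t y / p t y| - ε * (g t y ^ 2 / p t y)) 0) +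
          ε * ∫ y, g t y ^ 2 / p t y := by
        rw [integral_add hmax (hI.1.const_mul ε), integral_const_mul]
    _ < η / 2 + η / 2 := by
        refine add_lt_add_of_lt_of_le ht1 ?_
        calc ε * ∫ y, g t y ^ 2 / p t y ≤ ε * ((1 + t) * J) := by gcongr; exact hI.2
          _ ≤ ε * (2 * (J + 1)) := by
            gcongr
            · linarith
            · linarith
          _ = η / 2 := by
            rw [hε]
            field_simp
            norm_num
    _ = η := by ring

end IsGaussianScaleMixture

/-! ### The statistical model -/

theorem IsContinuousDensity.continuousDensity_eq {μ : Measure ℝ} [IsFiniteMeasure μ] {f : ℝ → ℝ}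
    (hf : IsContinuousDensity μ f) : continuousDensity μ = f := by
  have h : ∃ f, IsContinuousDensity μ f := ⟨f, hf⟩
  rw [continuousDensity, dif_pos h]
  exact h.choose_spec.unique hf

namespace IsGaussianScaleMixture

variable {β : ℝ} {ρ : Measure ℝ}

theorem isContinuousDensity_map_one (H : IsGaussianScaleMixture β ρ) (hβ : 0 < β) {Ω : Type*}
    [MeasurableSpace Ω] {P : Measure Ω} [IsProbabilityMeasure P] {W : ℝ≥0 → Ω → ℝ}
    (hW : IsStandardSymmetricStable β W P) :
    IsContinuousDensity (P.map (W 1)) (stableDensity β) where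
  continuous := H.continuous_stableDensity
  nonneg x := (H.stableDensity_pos x).le
  eq_withDensity := by
    rw [H.map_stable_eq hβ hW]
    simp

theorem continuous_shiftedDensity (H : IsGaussianScaleMixture β ρ) (t : ℝ≥0) (δ : ℝ) :
    Continuous (shiftedDensity β t δ) :=
  continuous_of_dominated (fun _ => Measurable.of_discrete.aestronglyMeasurable)
    (fun _ => ae_of_all _ fun _ => H.stableDensity_le _) (integrable_const _)
    (ae_of_all _ fun _ => H.continuous_stableDensity.comp (by fun_prop))

theorem inv_mul_shiftedDensity_eq (β : ℝ) (t : ℝ≥0) (θ r x : ℝ) :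
    r⁻¹ * shiftedDensity β t (θ / r) (x / r) =
      ∫ k : ℕ, r⁻¹ * stableDensity β ((x - k * θ) / r) ∂(poissonMeasure t) := by
  rw [shiftedDensity, ← integral_const_mul]
  simp only [sub_div, mul_div_assoc]

/-- The observation `σ W_Δ + θ Y_Δ` is a mixture over the number of jumps. -/
theorem isContinuousDensity_additiveModel (H : IsGaussianScaleMixture β ρ) (hβ : 0 < β)
    {Ω : Type*} [MeasurableSpace Ω] {P : Measure Ω} [IsProbabilityMeasure P] {W Y : ℝ≥0 → Ω → ℝ}
    (hW : IsStandardSymmetricStable β W P) (hY : IsStandardPoisson Y P)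
    (hWY : IndepFun (fun ω t => W t ω) (fun ω t => Y t ω) P) {t : ℝ≥0} (ht : 0 < t)
    {σ : ℝ} (hσ : 0 < σ) (θ : ℝ) :
    IsContinuousDensity (additiveModel P W Y t σ θ) fun x => (σ * (t : ℝ) ^ (1 / β))⁻¹ *
      shiftedDensity β t (θ / (σ * (t : ℝ) ^ (1 / β))) (x / (σ * (t : ℝ) ^ (1 / β))) := by
  have ht' : (0 : ℝ) < t := ht
  have hr : 0 < σ * (t : ℝ) ^ (1 / β) := by positivity
  have := H.isProbabilityMeasure
  have hWm := hW.levy.aemeasurable t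
  have hYm := hY.levy.aemeasurable t
  refine ⟨?_, fun x => ?_, ?_⟩
  · exact continuous_const.mul ((H.continuous_shiftedDensity t _).comp (by fun_prop))
  · exact mul_nonneg (inv_pos.2 hr).le (H.shiftedDensity_pos t _ _).le
  · have hind : IndepFun (W t) (Y t) P :=
      hWY.comp (φ := fun w : ℝ≥0 → ℝ => w t) (ψ := fun y : ℝ≥0 → ℝ => y t) (by fun_prop)
        (by fun_prop)
    have hjoint := hind.symm.map_prod_eq_prod_map_map hYm hWm
    have hcast : Measurable fun n : ℕ => (n : ℝ) := Measurable.of_discrete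
    rw [hY.law_eq, H.map_stable_eq hβ hW, Measure.map_prod_map _ _ hcast (by fun_prop)] at hjoint
    have h1 : additiveModel P W Y t σ θ =
        (P.map fun ω => (Y t ω, W t ω)).map fun p : ℝ × ℝ => σ * p.2 + θ * p.1 := by
      rw [AEMeasurable.map_map_of_aemeasurable (by fun_prop) (hYm.prodMk hWm)]
      rfl
    have hm : Measurable fun k : ℕ => (k : ℝ) * θ := Measurable.of_discrete
    have h2 := map_locationScale_eq_withDensity (κ := poissonMeasure t)
      (m := fun k : ℕ => (k : ℝ) * θ) (r := fun _ => σ * (t : ℝ) ^ (1 / β)) hm measurable_const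
      (ae_of_all _ fun _ => hr) H.measurable_stableDensity (fun x => (H.stableDensity_pos x).le)
      (fun x => (Integrable.of_bound Measurable.of_discrete.aestronglyMeasurable _
        (ae_of_all _ fun _ => H.stableDensity_le _)).const_mul _)
    simp only [← inv_mul_shiftedDensity_eq] at h2
    rw [h1, hjoint, ← h2, Measure.map_map (by fun_prop) (hcast.prodMap (by fun_prop))]
    congr 1
    ext p
    simp only [Function.comp_apply, Prod.map_fst, Prod.map_snd]
    ring

/-- Differentiation in the scale, termwise over the number of jumps. -/
theorem hasDerivAt_scale (H : IsGaussianScaleMixture β ρ) (t : ℝ≥0) {d : ℝ} (hd : 0 < d)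
    {σ : ℝ} (hσ : 0 < σ) (θ x : ℝ) :
    HasDerivAt (fun s => (s * d)⁻¹ * shiftedDensity β t (θ / (s * d)) (x / (s * d)))
      (-σ⁻¹ * ((σ * d)⁻¹ * shiftedScaleDeriv β t (θ / (σ * d)) (x / (σ * d)))) σ := by
  have e : -σ⁻¹ * ((σ * d)⁻¹ * shiftedScaleDeriv β t (θ / (σ * d)) (x / (σ * d))) =
      ∫ k : ℕ, -σ⁻¹ * ((σ * d)⁻¹ * (stableDensity β ((x - k * θ) / (σ * d)) +
        (x - k * θ) / (σ * d) * deriv (stableDensity β) ((x - k * θ) / (σ * d))))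
        ∂(poissonMeasure t) := by
    rw [shiftedScaleDeriv, ← integral_const_mul, ← integral_const_mul]
    simp only [sub_div, mul_div_assoc]
  rw [e]
  simp only [inv_mul_shiftedDensity_eq]
  set C := ∫ r, r⁻¹ * 3 ∂ρ with hC
  refine (hasDerivAt_integral_of_dominated_loc_of_deriv_le (s := Set.Ioi (σ / 2))
    (F := fun s (k : ℕ) => (s * d)⁻¹ * stableDensity β ((x - k * θ) / (s * d)))
    (F' := fun s (k : ℕ) => -s⁻¹ * ((s * d)⁻¹ * (stableDensity β ((x - k * θ) / (s * d)) +
        (x - k * θ) / (s * d) * deriv (stableDensity β) ((x - k * θ) / (s * d)))))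
    (bound := fun _ => (σ / 2)⁻¹ * ((σ / 2 * d)⁻¹ * C)) (Ioi_mem_nhds (by linarith))
    (Eventually.of_forall fun _ => Measurable.of_discrete.aestronglyMeasurable) ?_
    Measurable.of_discrete.aestronglyMeasurable ?_ (integrable_const _) ?_).2
  · exact (Integrable.of_bound Measurable.of_discrete.aestronglyMeasurable _
      (ae_of_all _ fun _ => H.stableDensity_le _)).const_mul _
  · refine ae_of_all _ fun k s hs => ?_
    have hs' : σ / 2 < s := hs
    have hs0 : 0 < s := lt_trans (by positivity) hs'
    rw [norm_mul, norm_mul, norm_neg, Real.norm_of_nonneg (inv_pos.2 hs0).le,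
      Real.norm_of_nonneg (by positivity : 0 ≤ (s * d)⁻¹)]
    have h := H.abs_stableDensity_add_mul_deriv_le ((x - k * θ) / (s * d))
    rw [← hC] at h
    rw [Real.norm_eq_abs]
    gcongr
  · refine ae_of_all _ fun k s hs => ?_
    have hs0 : 0 < s := lt_trans (by positivity) (Set.mem_Ioi.1 hs)
    have h1 : HasDerivAt (fun s => s * d) d s := by simpa using (hasDerivAt_id s).mul_const d
    have h2 : HasDerivAt (fun s => (s * d)⁻¹) (-d / (s * d) ^ 2) s := h1.inv (by positivity)
    have h3 : HasDerivAt (fun s => (x - k * θ) / (s * d)) ((x - k * θ) * (-d / (s * d) ^ 2)) s := by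
      simpa only [div_eq_mul_inv (x - k * θ)] using h2.const_mul (x - k * θ)
    have h4 : HasDerivAt (fun s => stableDensity β ((x - k * θ) / (s * d)))
        (deriv (stableDensity β) ((x - k * θ) / (s * d)) *
          ((x - k * θ) * (-d / (s * d) ^ 2))) s := by
      have := (H.hasDerivAt_stableDensity
        ((x - k * θ) / (s * d))).2.differentiableAt.hasDerivAt.comp s h3
      exact this
    convert! h2.mul h4 using 1
    generalize deriv (stableDensity β) ((x - k * θ) / (s * d)) = D
    generalize stableDensity β ((x - k * θ) / (s * d)) = S
    field_simp
    ring

/-- Differentiation in the jump size, termwise over the number of jumps. -/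
theorem hasDerivAt_jump (H : IsGaussianScaleMixture β ρ) (t : ℝ≥0) (r θ x : ℝ) :
    HasDerivAt (fun s => r⁻¹ * shiftedDensity β t (s / r) (x / r))
      (-r⁻¹ * (r⁻¹ * shiftedJumpDeriv β t (θ / r) (x / r))) θ := by
  have h : HasDerivAt (fun s => shiftedDensity β t (s / r) (x / r))
      (∫ k : ℕ, -r⁻¹ * ((k : ℝ) * deriv (stableDensity β) (x / r - k * (θ / r)))
        ∂(poissonMeasure t)) θ := by
    have hd : ∀ (k : ℕ) (s : ℝ), HasDerivAt (fun s => stableDensity β (x / r - k * (s / r)))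
        (-r⁻¹ * ((k : ℝ) * deriv (stableDensity β) (x / r - k * (s / r)))) s := by
      intro k s
      have h1 : HasDerivAt (fun s => x / r - k * (s / r)) (-((k : ℝ) * (1 / r))) s :=
        (((hasDerivAt_id s).div_const r).const_mul (k : ℝ)).const_sub _
      have h2 := (H.hasDerivAt_stableDensity
        (x / r - k * (s / r))).2.differentiableAt.hasDerivAt.comp s h1
      convert! h2 using 1
      ring
    have hb : ∀ (k : ℕ) (s : ℝ),
        ‖-r⁻¹ * ((k : ℝ) * deriv (stableDensity β) (x / r - k * (s / r)))‖ ≤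
          |r⁻¹| * ((k : ℝ) * ∫ v, (v ^ 2)⁻¹ ∂ρ) := by
      intro k s
      rw [norm_mul, norm_mul, norm_neg, Real.norm_of_nonneg (Nat.cast_nonneg k), Real.norm_eq_abs]
      exact mul_le_mul_of_nonneg_left (mul_le_mul_of_nonneg_left (H.abs_deriv_le _)
        (Nat.cast_nonneg k)) (abs_nonneg _)
    exact (hasDerivAt_integral_of_dominated_loc_of_deriv_le (s := Set.univ)
      (F := fun s (k : ℕ) => stableDensity β (x / r - k * (s / r)))
      (F' := fun s (k : ℕ) => -r⁻¹ * ((k : ℝ) * deriv (stableDensity β) (x / r - k * (s / r))))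
      univ_mem (Eventually.of_forall fun _ => Measurable.of_discrete.aestronglyMeasurable)
      (H.integrable_shiftedDensity t _ _) Measurable.of_discrete.aestronglyMeasurable
      (ae_of_all _ fun k s _ => hb k s)
      (((integrable_natCast_poissonMeasure t).mul_const _).const_mul _)
      (ae_of_all _ fun k s _ => hd k s)).2
  convert! h.const_mul r⁻¹ using 1
  rw [shiftedJumpDeriv, integral_const_mul]
  ring

end IsGaussianScaleMixture

section Model

variable {β : ℝ} {ρ : Measure ℝ} {Ω : Type*} [MeasurableSpace Ω] {P : Measure Ω}
  [IsProbabilityMeasure P] {W Y : ℝ≥0 → Ω → ℝ} {t : ℝ≥0} {σ : ℝ}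

theorem isFiniteMeasure_additiveModel (P : Measure Ω) [IsProbabilityMeasure P] (W Y : ℝ≥0 → Ω → ℝ)
    (t : ℝ≥0) (σ θ : ℝ) : IsFiniteMeasure (additiveModel P W Y t σ θ) := by
  unfold additiveModel
  infer_instance

theorem modelDensity_additiveModel (H : IsGaussianScaleMixture β ρ) (hβ : 0 < β)
    (hW : IsStandardSymmetricStable β W P) (hY : IsStandardPoisson Y P)
    (hWY : IndepFun (fun ω t => W t ω) (fun ω t => Y t ω) P) (ht : 0 < t) (hσ : 0 < σ) (θ : ℝ) :
    modelDensity (additiveModel P W Y t) σ θ = fun x => (σ * (t : ℝ) ^ (1 / β))⁻¹ *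
      shiftedDensity β t (θ / (σ * (t : ℝ) ^ (1 / β))) (x / (σ * (t : ℝ) ^ (1 / β))) := by
  have := isFiniteMeasure_additiveModel P W Y t σ θ
  exact (H.isContinuousDensity_additiveModel hβ hW hY hWY ht hσ θ).continuousDensity_eq

theorem hasDerivAt_modelDensity₁ (H : IsGaussianScaleMixture β ρ) (hβ : 0 < β)
    (hW : IsStandardSymmetricStable β W P) (hY : IsStandardPoisson Y P)
    (hWY : IndepFun (fun ω t => W t ω) (fun ω t => Y t ω) P) (ht : 0 < t) (hσ : 0 < σ)
    (θ x : ℝ) :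
    HasDerivAt (fun s => modelDensity (additiveModel P W Y t) s θ x)
      (-σ⁻¹ * ((σ * (t : ℝ) ^ (1 / β))⁻¹ *
        shiftedScaleDeriv β t (θ / (σ * (t : ℝ) ^ (1 / β))) (x / (σ * (t : ℝ) ^ (1 / β))))) σ := by
  have ht' : (0 : ℝ) < t := ht
  refine (H.hasDerivAt_scale t (by positivity) hσ θ x).congr_of_eventuallyEq ?_
  filter_upwards [Ioi_mem_nhds hσ] with s hs
  rw [modelDensity_additiveModel H hβ hW hY hWY ht hs θ]

theorem hasDerivAt_modelDensity₂ (H : IsGaussianScaleMixture β ρ) (hβ : 0 < β)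
    (hW : IsStandardSymmetricStable β W P) (hY : IsStandardPoisson Y P)
    (hWY : IndepFun (fun ω t => W t ω) (fun ω t => Y t ω) P) (ht : 0 < t) (hσ : 0 < σ)
    (θ x : ℝ) :
    HasDerivAt (fun s => modelDensity (additiveModel P W Y t) σ s x)
      (-(σ * (t : ℝ) ^ (1 / β))⁻¹ * ((σ * (t : ℝ) ^ (1 / β))⁻¹ *
        shiftedJumpDeriv β t (θ / (σ * (t : ℝ) ^ (1 / β))) (x / (σ * (t : ℝ) ^ (1 / β))))) θ := by
  refine (H.hasDerivAt_jump t (σ * (t : ℝ) ^ (1 / β)) θ x).congr_of_eventuallyEq ?_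
  filter_upwards with s
  rw [modelDensity_additiveModel H hβ hW hY hWY ht hσ s]

/-- The integrands of the Fisher informations, in terms of the rescaled observation. -/
theorem fisher_integrands_eq (H : IsGaussianScaleMixture β ρ) (hβ : 0 < β)
    (hW : IsStandardSymmetricStable β W P) (hY : IsStandardPoisson Y P)
    (hWY : IndepFun (fun ω t => W t ω) (fun ω t => Y t ω) P) (ht : 0 < t) (hσ : 0 < σ)
    (θ : ℝ) {r : ℝ} (hr : r = σ * (t : ℝ) ^ (1 / β)) (x : ℝ) :
    modelDeriv₁ (additiveModel P W Y t) σ θ x ^ 2 / modelDensity (additiveModel P W Y t) σ θ x =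
      1 / σ ^ 2 * r⁻¹ * (fun y => shiftedScaleDeriv β t (θ / r) y ^ 2 /
        shiftedDensity β t (θ / r) y) (x / r) ∧
    modelDeriv₁ (additiveModel P W Y t) σ θ x * modelDeriv₂ (additiveModel P W Y t) σ θ x /
        modelDensity (additiveModel P W Y t) σ θ x =
      (σ * r)⁻¹ * r⁻¹ * (fun y => shiftedScaleDeriv β t (θ / r) y *
        shiftedJumpDeriv β t (θ / r) y / shiftedDensity β t (θ / r) y) (x / r) ∧
    modelDeriv₂ (additiveModel P W Y t) σ θ x ^ 2 / modelDensity (additiveModel P W Y t) σ θ x =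
      1 / r ^ 2 * r⁻¹ * (fun y => shiftedJumpDeriv β t (θ / r) y ^ 2 /
        shiftedDensity β t (θ / r) y) (x / r) := by
  have ht' : (0 : ℝ) < t := ht
  have hr0 : 0 < r := by
    rw [hr]
    positivity
  have h1 : modelDeriv₁ (additiveModel P W Y t) σ θ x = _ :=
    (hasDerivAt_modelDensity₁ H hβ hW hY hWY ht hσ θ x).deriv
  have h2 : modelDeriv₂ (additiveModel P W Y t) σ θ x = _ :=
    (hasDerivAt_modelDensity₂ H hβ hW hY hWY ht hσ θ x).deriv
  have hp := (H.shiftedDensity_pos t (θ / r) (x / r)).ne'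
  rw [h1, h2, modelDensity_additiveModel H hβ hW hY hWY ht hσ θ, ← hr]
  refine ⟨?_, ?_, ?_⟩ <;> field_simp

theorem hasFisherInfo_additiveModel (H : IsGaussianScaleMixture β ρ) (hβ : 0 < β)
    (hW : IsStandardSymmetricStable β W P) (hY : IsStandardPoisson Y P)
    (hWY : IndepFun (fun ω t => W t ω) (fun ω t => Y t ω) P) (ht : 0 < t) (hσ : 0 < σ)
    (θ : ℝ) : HasFisherInfo (additiveModel P W Y t) σ θ := by
  have ht' : (0 : ℝ) < t := ht
  have hr0 : 0 < σ * (t : ℝ) ^ (1 / β) := by positivity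
  have hI := fisher_integrands_eq H hβ hW hY hWY ht hσ θ rfl
  refine ⟨?_, fun x => ?_, fun x => ?_, fun x => ?_, ?_, ?_, ?_⟩
  · have hev : ∀ᶠ q : ℝ × ℝ in 𝓝 (σ, θ), 0 < q.1 :=
      continuous_fst.continuousAt.eventually (lt_mem_nhds hσ)
    filter_upwards [hev] with q hq
    rw [modelDensity_additiveModel H hβ hW hY hWY ht hq q.2]
    exact H.isContinuousDensity_additiveModel hβ hW hY hWY ht hq q.2
  · rw [modelDensity_additiveModel H hβ hW hY hWY ht hσ θ]
    exact mul_pos (inv_pos.2 hr0) (H.shiftedDensity_pos _ _ _)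
  · exact (hasDerivAt_modelDensity₁ H hβ hW hY hWY ht hσ θ x).differentiableAt
  · exact (hasDerivAt_modelDensity₂ H hβ hW hY hWY ht hσ θ x).differentiableAt
  · simp_rw [fun x => (hI x).1]
    exact ((H.integral_scale_le t _).1.comp_div hr0.ne').const_mul _
  · simp_rw [fun x => (hI x).2.1]
    exact ((H.integrable_mixed t _).comp_div hr0.ne').const_mul _
  · simp_rw [fun x => (hI x).2.2]
    exact ((H.integral_jump_le t _).1.comp_div hr0.ne').const_mul _

theorem fisherInfo_additiveModel_eq (H : IsGaussianScaleMixture β ρ) (hβ : 0 < β)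
    (hW : IsStandardSymmetricStable β W P) (hY : IsStandardPoisson Y P)
    (hWY : IndepFun (fun ω t => W t ω) (fun ω t => Y t ω) P) (ht : 0 < t) (hσ : 0 < σ)
    (θ : ℝ) {r : ℝ} (hr : r = σ * (t : ℝ) ^ (1 / β)) :
    fisherInfo₁₁ (additiveModel P W Y t) σ θ = 1 / σ ^ 2 * ∫ y,
      shiftedScaleDeriv β t (θ / r) y ^ 2 / shiftedDensity β t (θ / r) y ∧
    fisherInfo₁₂ (additiveModel P W Y t) σ θ = (σ * r)⁻¹ * ∫ y,
      shiftedScaleDeriv β t (θ / r) y * shiftedJumpDeriv β t (θ / r) y /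
        shiftedDensity β t (θ / r) y ∧
    fisherInfo₂₂ (additiveModel P W Y t) σ θ = 1 / r ^ 2 * ∫ y,
      shiftedJumpDeriv β t (θ / r) y ^ 2 / shiftedDensity β t (θ / r) y := by
  have ht' : (0 : ℝ) < t := ht
  have hr0 : 0 < r := by
    rw [hr]
    positivity
  have hI := fisher_integrands_eq H hβ hW hY hWY ht hσ θ hr
  have hcv : ∀ (c : ℝ) (g : ℝ → ℝ), ∫ x, c * r⁻¹ * g (x / r) = c * ∫ y, g y := by
    intro c g
    rw [integral_const_mul, Measure.integral_comp_div, abs_of_pos hr0, smul_eq_mul, mul_assoc,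
      inv_mul_cancel_left₀ hr0.ne']
  refine ⟨?_, ?_, ?_⟩
  · rw [fisherInfo₁₁, integral_congr_ae (ae_of_all _ fun x => (hI x).1)]
    exact hcv _ fun y => shiftedScaleDeriv β t (θ / r) y ^ 2 /
      shiftedDensity β t (θ / r) y
  · rw [fisherInfo₁₂, integral_congr_ae (ae_of_all _ fun x => (hI x).2.1)]
    exact hcv _ fun y => shiftedScaleDeriv β t (θ / r) y * shiftedJumpDeriv β t (θ / r) y /
      shiftedDensity β t (θ / r) y
  · rw [fisherInfo₂₂, integral_congr_ae (ae_of_all _ fun x => (hI x).2.2)]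
    exact hcv _ fun y => shiftedJumpDeriv β t (θ / r) y ^ 2 /
      shiftedDensity β t (θ / r) y

end Model

/-- The first three conjuncts say that the objects in the limits are what they are meant to be:
`h_β` is the density of `W_1`, it is smooth and positive, the two informations are finite, and the
Fisher information matrix of a single observation exists. -/
theorem theorem5 {Ω : Type*} [MeasurableSpace Ω] (P : Measure Ω) [IsProbabilityMeasure P]
    (W Y : ℝ≥0 → Ω → ℝ) (β : ℝ) (hβ : 0 < β) (hβ' : β ≤ 2)
    (hW : IsStandardSymmetricStable β W P) (hY : IsStandardPoisson Y P)
    (hWY : IndepFun (fun ω t => W t ω) (fun ω t => Y t ω) P)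
    (σ θ : ℝ) (hσ : 0 < σ) :
    (IsContinuousDensity (P.map (W 1)) (stableDensity β) ∧
      ContDiff ℝ (⊤ : ℕ∞) (stableDensity β) ∧ ∀ w, 0 < stableDensity β w) ∧
    (Integrable (scaleIntegrand β) ∧ Integrable (translationIntegrand β)) ∧
    (∀ Δ : ℝ≥0, 0 < Δ → HasFisherInfo (additiveModel P W Y Δ) σ θ) ∧
    Tendsto (fun Δ : ℝ≥0 => fisherInfo₁₁ (additiveModel P W Y Δ) σ θ)
      (𝓝[>] 0) (𝓝 (1 / σ ^ 2 * scaleInfo β)) ∧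
    Tendsto (fun Δ : ℝ≥0 => (Δ : ℝ) ^ (1 / β - 1 / 2) *
        fisherInfo₁₂ (additiveModel P W Y Δ) σ θ)
      (𝓝[>] 0) (𝓝 0) ∧
    (θ ≠ 0 → Tendsto (fun Δ : ℝ≥0 => (Δ : ℝ) ^ (2 / β - 1) *
        fisherInfo₂₂ (additiveModel P W Y Δ) σ θ)
      (𝓝[>] 0) (𝓝 (1 / σ ^ 2 * translationInfo β))) := by
  obtain ⟨ρ, H⟩ := exists_isGaussianScaleMixture hβ hβ'
  have hF := fun (t : ℝ≥0) (ht : 0 < t) =>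
    fisherInfo_additiveModel_eq H hβ hW hY hWY ht hσ θ (r := σ * (t : ℝ) ^ (1 / β)) rfl
  refine ⟨⟨H.isContinuousDensity_map_one hβ hW, contDiff_stableDensity hβ, H.stableDensity_pos⟩,
    ⟨H.integrable_scaleIntegrand, H.integrable_translationIntegrand⟩,
    fun t ht => hasFisherInfo_additiveModel H hβ hW hY hWY ht hσ θ, ?_, ?_, fun hθ => ?_⟩
  · refine ((H.tendsto_integral_scale fun t => θ / (σ * (t : ℝ) ^ (1 / β))).const_mul
      (1 / σ ^ 2)).congr' ?_
    filter_upwards [self_mem_nhdsWithin] with t ht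
    exact (hF t ht).1.symm
  · have h := (H.tendsto_integral_mixed fun t => θ / (σ * (t : ℝ) ^ (1 / β))).const_mul
      (1 / σ ^ 2)
    rw [mul_zero] at h
    refine h.congr' ?_
    filter_upwards [self_mem_nhdsWithin] with t ht
    have ht' : (0 : ℝ) < t := ht
    have e : (t : ℝ) ^ (1 / β - 1 / 2) = (t : ℝ) ^ (1 / β) * (t : ℝ) ^ (-(1 / 2) : ℝ) := by
      rw [← Real.rpow_add ht']
      ring_nf
    have hd : 0 < (t : ℝ) ^ (1 / β) := by positivity
    rw [(hF t ht).2.1, e]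
    field_simp
  · have h := (H.tendsto_integral_jump hβ (div_ne_zero hθ hσ.ne')).const_mul (1 / σ ^ 2)
    refine h.congr' ?_
    filter_upwards [self_mem_nhdsWithin] with t ht
    have ht' : (0 : ℝ) < t := ht
    have e : (t : ℝ) ^ (2 / β - 1) = ((t : ℝ) ^ (1 / β)) ^ 2 * (t : ℝ)⁻¹ := by
      rw [← Real.rpow_natCast, ← Real.rpow_mul ht'.le, Real.rpow_sub_one ht'.ne',
        div_eq_mul_inv _ (t : ℝ)]
      push_cast
      ring_nf
    have hd : 0 < (t : ℝ) ^ (1 / β) := by positivity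
    rw [(hF t ht).2.2, e, div_div]
    field_simp
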